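/- **Setting.** Let $U$ be a compact metric space, $Y\subset\mathbb R^m$ and $Z\subset\mathbb R^n$ compact, $C>0$, and let $f:U\times\mathbb R^m\times\mathbb R^n\to\mathbb R^m$, $g:U\times\mathbb R^m\times\mathbb R^n\to\mathbb R^n$, $G:U\times\mathbb R^m\times\mathbb R^n\to\mathbb R$ be continuous, with $f,g$ Lipschitz in $(y,z)$ uniformly in $u$. For $\epsilon>0$ consider the singularly perturbed (SP) system $$\epsilon y'(t)=f(u(t),y(t),z(t)),\qquad z'(t)=g(u(t),y(t),z(t)),\qquad (y(0),z(0))=(y_0,z_0),$$ with measurable controls $u:[0,\infty)\to U$ (solutions of all equations are absolutely continuous and the equations hold a.e.). Assume that, for small $\epsilon$, all solutions stay in $Y\times Z$. Put $$V^*_{di}(\epsilon)=\inf_{u(\cdot)}\int_0^\infty e^{-Ct}G(u(t),y_\epsilon(t),z_\epsilon(t))\,dt .$$ *Associated system.* For $z\in Z$, an admissible pair of the associated system is a measurable $u:[0,\infty)\to U$ together with an absolutely continuous $y:[0,\infty)\to Y$ such that $y'(\tau)=f(u(\tau),y(\tau),z)$ a.e. Let $\mathcal P(X)$ denote the Borel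 probability measures on $X$. The occupational measure of a measurable $w:[0,\infty)\to X$ on $[0,S]$ is $Q\mapsto S^{-1}\int_0^S 1_Q(w(t))\,dt$; the occupational measure on $[0,\infty)$ is the weak limit as $S\to\infty$, if it exists. Fix $\rho(\gamma,\gamma')=\sum_{l\ge1}2^{-l}|\int q_l\,d\gamma-\int q_l\,d\gamma'|$, where $(q_l)$ is a sequence of Lipschitz functions dense in the unit ball of $C(U\times Y)$. For $\mu\in\mathcal P(U\times Y)$ and a function $q(u,y,z)$ write $\tilde q(\mu,z)=\int_{U\times Y}q(u,y,z)\,\mu(du,dy)$. *Averaged problem.* Let $W(z)$ be the set of $\mu\in\mathcal P(U\times Y)$ with $\int\nabla\phi(y)^Tf(u,y,z)\,\mu(du,dy)=0$ for all $\phi\in C^1(\mathbb R^m)$, and let $F=\{(\mu,z):z\in Z,\ \mu\in W(z)\}$. Define $$\tilde V^*_{di}(z_0)=\inf\int_0^\infty e^{-Ct}\tilde G(\mu(t),z(t))\,dt$$ over measurable $\mu(\cdot)$ and absolutely continuous $z(\cdot)$ with values in $Z$ such that $z'=\tilde g(\mu(t),z(t))$ and $\mu(t)\in W(z(t))$ for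 a.e. $t$, and $z(0)=z_0$. Define $\tilde G^*_{di}(z_0)=\inf\int_F\tilde G\,dp$ over those $p\in\mathcal P(F)$ with $\int_F\big(\nabla\psi(z)^T\tilde g(\mu,z)+C(\psi(z_0)-\psi(z))\big)\,p(d\mu,dz)=0$ for all $\psi\in C^1(\mathbb R^n)$. *ACG families.* An average control generating (ACG) family consists of admissible pairs $(u_z(\cdot),y_z(\cdot))$ of the associated system, $z\in Z$, having occupational measures $\mu(\cdot|z)$ on $[0,\infty)$ such that, for every continuous $q(u,y,z)$, the function $\tilde q_\mu(z):=\tilde q(\mu(\cdot|z),z)$ is measurable on $Z$ and $|S^{-1}\int_0^Sq(u_z(\tau),y_z(\tau),z)\,d\tau-\tilde q_\mu(z)|\le\phi_q(S)$ for all $z\in Z$, $S>0$, with $\phi_q(S)\to0$ as $S\to\infty$; and such that $z'=\tilde g_\mu(z)$, $z(0)=z_0$, has a unique solution $z(\cdot)$ with values in $Z$ on $[0,\infty)$. The family is optimal if $\int_0^\infty e^{-Ct}\tilde G_\mu(z(t))\,dt=\tilde V^*_{di}(z_0)$, and $\alpha$-near optimal ($\alpha>0$) if this integral is $\le\tilde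 V^*_{di}(z_0)+\alpha$. *Piecewise Lipschitz continuity.* A function $h$ on $Z$ is piecewise Lipschitz continuous near $z(\cdot)$ if for every $T>0$ there are finitely many $\bar t_i\in[0,T]$, radii $a_t>0$ ($t\in[0,T]$, $t\ne\bar t_i$) and a constant $K$ such that $h$ is $K$-Lipschitz on $Z\cap(z(t)+a_tB)$ for every $t\neq\bar t_i$ ($B$ the open unit ball), and such that for every $\delta>0$ the $a_t$ with $t\in[0,T]\setminus\bigcup_i(\bar t_i-\delta,\bar t_i+\delta)$ are bounded below by a positive number. **Statement.** Suppose that $(u_z(\cdot),y_z(\cdot))$ is an ACG family, with $\mu(\cdot|z)$ and $z(\cdot)$ as above, and: 1. (uniform attainability) for all $y\in Y$, $z\in Z$ there is an admissible pair $(u_{y,z}(\cdot),y_{y,z}(\cdot))$ of the associated system with $y_{y,z}(0)=y$ whose occupational measure on $[0,S]$ is within $\rho$-distance $\phi(S)$ of $\mu(\cdot|z)$, where $\phi$ does not depend on $(y,z)$ and $\phi(S)\to0$ as $S\to\infty$; 2. (weak piecewise Lipschitz continuity) $\tilde q_\mu$ for every Lipschitz $q(u,y,z)$, and $\tilde g_\mu$,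 are piecewise Lipschitz continuous near $z(\cdot)$; 3. $L_f>0$ is a Lipschitz constant of $f$ in $(y,z)$ on $Y\times Z$, $\Delta(\epsilon)=\frac{\epsilon}{2L_f}\ln\frac1\epsilon$, $t_l=l\Delta(\epsilon)$, and for small $\epsilon>0$ the control $u_\epsilon(\cdot)$, with the corresponding solution $(y_\epsilon(\cdot),z_\epsilon(\cdot))$ of the SP system, is the one constructed successively by $$u_\epsilon(t)=u_{y_\epsilon(t_l),z_\epsilon(t_l)}\Big(\frac{t-t_l}{\epsilon}\Big),\qquad t\in[t_l,t_{l+1}),\quad l=0,1,\dots;$$ 4. for every $T>0$ there are $\bar t_i$ and $a_t$ as in the definition of the piecewise Lipschitz continuity of $\tilde g_\mu$, and $\bar\delta_T(\epsilon)>0$ with $\bar\delta_T(\epsilon)\to0$ as $\epsilon\to0$, such that for small $\epsilon$, $z_\epsilon(t)\in z(t)+a_tB$ for all $t\in[0,T]\setminus\bigcup_i(\bar t_i-\bar\delta_T(\epsilon),\bar t_i+\bar\delta_T(\epsilon))$; 5. $\lim_{\epsilon\to0}V^*_{di}(\epsilon)=\tilde V^*_{di}(z_0)$ or $C\,\tilde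 V^*_{di}(z_0)=\tilde G^*_{di}(z_0)$. If the ACG family is optimal, then $u_\epsilon$ is asymptotically optimal: both limits below exist and $$\lim_{\epsilon\to0}\int_0^\infty e^{-Ct}G(u_\epsilon(t),y_\epsilon(t),z_\epsilon(t))\,dt=\lim_{\epsilon\to0}V^*_{di}(\epsilon).$$ If, for some $\alpha>0$, the ACG family is $\alpha$-near optimal, then $u_\epsilon$ is asymptotically $\alpha$-near optimal: the limit on the left exists and $$\lim_{\epsilon\to0}\int_0^\infty e^{-Ct}G(u_\epsilon(t),y_\epsilon(t),z_\epsilon(t))\,dt\le\liminf_{\epsilon\to0}V^*_{di}(\epsilon)+\alpha .$$ -/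

import Mathlib

open MeasureTheory Filter Topology Set
open scoped NNReal ENNReal

noncomputable section

/-- Euclidean space of dimension `k`. -/
abbrev Euc (k : ℕ) := EuclideanSpace ℝ (Fin k)

/-- `x` is a Carathéodory solution on `[0, ∞)` of `x'(t) = v(t)`: `v` is locally integrable and `x`
is its indefinite integral (equivalently, `x` is locally absolutely continuous and `x' = v`
almost everywhere). -/
def HasVelocity {k : ℕ} (x v : ℝ → Euc k) : Prop :=
  ∀ t : ℝ, 0 ≤ t → IntervalIntegrable v volume 0 t ∧ x t = x 0 + ∫ s in (0 : ℝ)..t, v s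

section Occupational

variable {W : Type*} [TopologicalSpace W] [MeasurableSpace W]

/-- The occupational measure of `w` on `[0, S]`: `Q ↦ S⁻¹ ∫₀ˢ 1_Q (w t) dt`. -/
def occupOn (w : ℝ → W) (S : ℝ) : Measure W :=
  (ENNReal.ofReal S)⁻¹ • (volume.restrict (Icc 0 S)).map w

/-- `γ` is the occupational measure generated by `w` on `[0, ∞)`:
the time averages of every continuous function along `w` converge to its integral. -/
def IsOccupational (w : ℝ → W) (γ : ProbabilityMeasure W) : Prop :=
  ∀ q : W → ℝ, Continuous q →
    Tendsto (fun S : ℝ => S⁻¹ * ∫ t in (0 : ℝ)..S, q (w t)) atTop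
      (𝓝 (∫ w, q w ∂(γ : Measure W)))

/-- The metric `ρ(γ, γ') = ∑ₗ 2⁻ˡ |∫ qₗ dγ - ∫ qₗ dγ'|` (sum over `l ≥ 1`) built on a sequence of
test functions (here numbered from `0`). -/
def rhoDist (q : ℕ → W → ℝ) (γ γ' : Measure W) : ℝ :=
  ∑' l : ℕ, (1 / 2 : ℝ) ^ (l + 1) * |(∫ w, q l w ∂γ) - ∫ w, q l w ∂γ'|

end Occupational

/-- `q` is a sequence of Lipschitz functions of sup norm at most one that is dense in the unit ball
of the space of continuous functions on `W`. -/
def IsTestSequence {W : Type*} [PseudoMetricSpace W] (q : ℕ → W → ℝ) : Prop :=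
  (∀ l, ∃ K : ℝ≥0, LipschitzWith K (q l)) ∧
  (∀ l w, |q l w| ≤ 1) ∧
  ∀ h : W → ℝ, Continuous h → (∀ w, |h w| ≤ 1) →
    ∀ η : ℝ, 0 < η → ∃ l, ∀ w, |q l w - h w| ≤ η

/-- `h` is Lipschitz on the part of the tube around `z` on `[0, T]` given by the open balls of
radius `a t` about `z t`, for `t` outside of the finite set `s`; the radii are
bounded away from zero off each neighbourhood of `s`. (Balls are taken in the domain `Z` of `h`.) -/
def PiecewiseLipschitzTube {Z V : Type*} [PseudoMetricSpace Z] [PseudoMetricSpace V]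
    (h : Z → V) (z : ℝ → Z) (T : ℝ) (s : Finset ℝ) (a : ℝ → ℝ) : Prop :=
  (∀ x ∈ s, x ∈ Icc 0 T) ∧
  (∀ t ∈ Icc 0 T, t ∉ s → 0 < a t) ∧
  (∃ K : ℝ≥0, ∀ t ∈ Icc 0 T, t ∉ s → LipschitzOnWith K h (Metric.ball (z t) (a t))) ∧
  ∀ δ : ℝ, 0 < δ → ∃ r : ℝ, 0 < r ∧
    ∀ t ∈ Icc 0 T, (∀ x ∈ s, t ∉ Ioo (x - δ) (x + δ)) → r ≤ a t

/-- Piecewise Lipschitz continuity of `h` in a neighbourhood of `z`. -/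
def IsPiecewiseLipschitzNear {Z V : Type*} [PseudoMetricSpace Z] [PseudoMetricSpace V]
    (h : Z → V) (z : ℝ → Z) : Prop :=
  ∀ T : ℝ, 0 < T → ∃ (s : Finset ℝ) (a : ℝ → ℝ), PiecewiseLipschitzTube h z T s a

/-- The data of a singularly perturbed optimal control problem: the right-hand sides, the running
cost, the state constraint sets, the initial state and the discount rate. -/
structure SPProblem (U : Type*) (m n : ℕ) where
  f : U × Euc m × Euc n → Euc m
  g : U × Euc m × Euc n → Euc n
  G : U × Euc m × Euc n → ℝ
  Y : Set (Euc m)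
  Z : Set (Euc n)
  y0 : Euc m
  z0 : Euc n
  C : ℝ

namespace SPProblem

variable {U : Type*} {m n : ℕ} [MetricSpace U] [MeasurableSpace U]

/-- `(u, y, z)` is a control together with a solution of `ε y' = f(u,y,z)`, `z' = g(u,y,z)`,
`(y(0), z(0)) = (y0, z0)`. -/
def IsSPTriple (P : SPProblem U m n) (ε : ℝ) (u : ℝ → U) (y : ℝ → Euc m) (z : ℝ → Euc n) : Prop :=
  Measurable u ∧ y 0 = P.y0 ∧ z 0 = P.z0 ∧
  HasVelocity y (fun t => ε⁻¹ • P.f (u t, y t, z t)) ∧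
  HasVelocity z (fun t => P.g (u t, y t, z t))

/-- The discounted cost. -/
def cost (P : SPProblem U m n) (u : ℝ → U) (y : ℝ → Euc m) (z : ℝ → Euc n) : ℝ :=
  ∫ t in Ioi (0 : ℝ), Real.exp (-(P.C * t)) * P.G (u t, y t, z t)

/-- The optimal value `V*_di(ε, y0, z0)` of the singularly perturbed problem. -/
def value (P : SPProblem U m n) (ε : ℝ) : ℝ :=
  sInf {c : ℝ | ∃ u y z, P.IsSPTriple ε u y z ∧ c = P.cost u y z}

/-- The standing assumptions on a singularly perturbed problem. -/
structure Standing (P : SPProblem U m n) : Prop where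
  f_cont : Continuous P.f
  g_cont : Continuous P.g
  G_cont : Continuous P.G
  f_lip : ∃ K : ℝ≥0, ∀ u, LipschitzWith K (fun x : Euc m × Euc n => P.f (u, x))
  g_lip : ∃ K : ℝ≥0, ∀ u, LipschitzWith K (fun x : Euc m × Euc n => P.g (u, x))
  Y_compact : IsCompact P.Y
  Z_compact : IsCompact P.Z
  C_pos : 0 < P.C
  invariant : ∀ᶠ ε in 𝓝[>] (0 : ℝ), ∀ u y z, P.IsSPTriple ε u y z →
    ∀ t : ℝ, 0 ≤ t → y t ∈ P.Y ∧ z t ∈ P.Z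

/-- Admissible pairs of the associated system `y' = f(u, y, ζ)`, `ζ` fixed, with `y` in `Y`. -/
def IsAssocAdmissible (P : SPProblem U m n) (ζ : P.Z) (u : ℝ → U) (y : ℝ → P.Y) : Prop :=
  Measurable u ∧
  HasVelocity (fun τ => (y τ : Euc m)) (fun τ => P.f (u τ, (y τ : Euc m), (ζ : Euc n)))

/-- The average `∫ q(u, y, ζ) μ(du, dy)` over `U × Y`. -/
def avg {V : Type*} [NormedAddCommGroup V] [NormedSpace ℝ V] (P : SPProblem U m n)
    (q : U × Euc m × Euc n → V) (μ : ProbabilityMeasure (U × P.Y)) (ζ : P.Z) : V :=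
  ∫ p, q (p.1, (p.2 : Euc m), (ζ : Euc n)) ∂(μ : Measure (U × P.Y))

/-- The set `W(ζ)` of probability measures on `U × Y` with `∫ ∇φ(y)ᵀ f(u, y, ζ) dμ = 0` for every
continuously differentiable `φ`. -/
def limitSet (P : SPProblem U m n) (ζ : P.Z) : Set (ProbabilityMeasure (U × P.Y)) :=
  {μ | ∀ φ : Euc m → ℝ, ContDiff ℝ 1 φ →
    ∫ p, fderiv ℝ φ (p.2 : Euc m) (P.f (p.1, (p.2 : Euc m), (ζ : Euc n)))
      ∂(μ : Measure (U × P.Y)) = 0}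

/-- Admissible pairs of the averaged system `z' = g̃(μ(t), z)`, `μ(t) ∈ W(z(t))`, with `z` in
`Z`. -/
def IsAvgAdmissible (P : SPProblem U m n) (μ : ℝ → ProbabilityMeasure (U × P.Y)) (z : ℝ → P.Z) :
    Prop :=
  Measurable μ ∧
  HasVelocity (fun t => (z t : Euc n)) (fun t => P.avg P.g (μ t) (z t)) ∧
  ∀ᵐ t ∂(volume.restrict (Ici (0 : ℝ))), μ t ∈ P.limitSet (z t)

/-- The discounted cost of a pair of the averaged system. -/
def avgCost (P : SPProblem U m n) (μ : ℝ → ProbabilityMeasure (U × P.Y)) (z : ℝ → P.Z) : ℝ :=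
  ∫ t in Ioi (0 : ℝ), Real.exp (-(P.C * t)) * P.avg P.G (μ t) (z t)

/-- The optimal value `Ṽ*_di(z0)` of the averaged problem. -/
def avgValue (P : SPProblem U m n) : ℝ :=
  sInf {c : ℝ | ∃ μ z, P.IsAvgAdmissible μ z ∧ (z 0 : Euc n) = P.z0 ∧ c = P.avgCost μ z}

/-- The graph `F` of `W(·)`. -/
def graphW (P : SPProblem U m n) : Set (ProbabilityMeasure (U × P.Y) × P.Z) :=
  {x | x.1 ∈ P.limitSet x.2}

/-- The feasible set `D̃_di(z0)` of the averaged infinite-dimensional linear program. -/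
def lpFeasible (P : SPProblem U m n) : Set (ProbabilityMeasure P.graphW) :=
  {p | ∀ ψ : Euc n → ℝ, ContDiff ℝ 1 ψ →
    ∫ x : P.graphW, (fderiv ℝ ψ (x.1.2 : Euc n) (P.avg P.g x.1.1 x.1.2)
      + P.C * (ψ P.z0 - ψ (x.1.2 : Euc n))) ∂(p : Measure P.graphW) = 0}

/-- The optimal value `G̃*_di(z0)` of the averaged infinite-dimensional linear program. -/
def lpValue (P : SPProblem U m n) : ℝ :=
  sInf {c : ℝ | ∃ p ∈ P.lpFeasible,
    c = ∫ x : P.graphW, P.avg P.G x.1.1 x.1.2 ∂(p : Measure P.graphW)}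

/-- `z` is a `Z`-valued solution of `z' = ∫ g(u, y, z) μ(du, dy | z)`, `z(0) = z0`. -/
def IsAvgFlow (P : SPProblem U m n) (μ : P.Z → ProbabilityMeasure (U × P.Y)) (z : ℝ → P.Z) :
    Prop :=
  (z 0 : Euc n) = P.z0 ∧
  HasVelocity (fun t => (z t : Euc n)) (fun t => P.avg P.g (μ (z t)) (z t))

/-- `(uz, yz)` is an average control generating family; `μ` is the family of occupational measures
and `z` the trajectory that it generates. -/
structure IsACGFamily (P : SPProblem U m n) (uz : P.Z → ℝ → U) (yz : P.Z → ℝ → P.Y)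
    (μ : P.Z → ProbabilityMeasure (U × P.Y)) (z : ℝ → P.Z) : Prop where
  admissible : ∀ ζ, P.IsAssocAdmissible ζ (uz ζ) (yz ζ)
  occupational : ∀ ζ, IsOccupational (fun τ => (uz ζ τ, yz ζ τ)) (μ ζ)
  measurable_avg : ∀ q : U × Euc m × Euc n → ℝ, Continuous q →
    Measurable (fun ζ : P.Z => P.avg q (μ ζ) ζ)
  uniform : ∀ q : U × Euc m × Euc n → ℝ, Continuous q →
    ∃ φ : ℝ → ℝ, Tendsto φ atTop (𝓝 0) ∧ ∀ S : ℝ, 0 < S → ∀ ζ : P.Z,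
      |S⁻¹ * (∫ τ in (0 : ℝ)..S, q (uz ζ τ, (yz ζ τ : Euc m), (ζ : Euc n)))
        - P.avg q (μ ζ) ζ| ≤ φ S
  flow : P.IsAvgFlow μ z
  unique : ∀ z' : ℝ → P.Z, P.IsAvgFlow μ z' → ∀ t : ℝ, 0 ≤ t → z' t = z t

/-- The family (through the averaged pair `(μ(z(t)), z(t))` it generates) is optimal in the averaged
problem. -/
def IsOptimalACG (P : SPProblem U m n) (μ : P.Z → ProbabilityMeasure (U × P.Y)) (z : ℝ → P.Z) :
    Prop :=
  P.avgCost (fun t => μ (z t)) z = P.avgValue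

/-- The family is `α`-near optimal in the averaged problem. -/
def IsNearOptimalACG (P : SPProblem U m n) (α : ℝ) (μ : P.Z → ProbabilityMeasure (U × P.Y))
    (z : ℝ → P.Z) : Prop :=
  P.avgCost (fun t => μ (z t)) z ≤ P.avgValue + α

/-- `us η ζ` (with trajectory `ys η ζ`) steers the associated system with parameter `ζ` from `η` to
`μ ζ`, uniformly in `η ∈ Y` and `ζ ∈ Z` in the metric `ρ`; the existence of such controls is the
uniform attainability of the family `μ`. -/
def IsUniformSteering (P : SPProblem U m n) (q : ℕ → U × P.Y → ℝ)
    (μ : P.Z → ProbabilityMeasure (U × P.Y))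
    (us : P.Y → P.Z → ℝ → U) (ys : P.Y → P.Z → ℝ → P.Y) : Prop :=
  (∀ η ζ, P.IsAssocAdmissible ζ (us η ζ) (ys η ζ) ∧ ys η ζ 0 = η) ∧
  ∃ φ : ℝ → ℝ, Tendsto φ atTop (𝓝 0) ∧ ∀ S : ℝ, 0 < S → ∀ η ζ,
    rhoDist q (occupOn (fun τ => (us η ζ τ, ys η ζ τ)) S) (μ ζ : Measure (U × P.Y)) ≤ φ S

/-- Weak piecewise Lipschitz continuity in a neighbourhood of `z`: the averages of all Lipschitz
functions, and that of `g`, are piecewise Lipschitz near `z`. -/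
def IsWeaklyPiecewiseLipschitz (P : SPProblem U m n)
    (μ : P.Z → ProbabilityMeasure (U × P.Y)) (z : ℝ → P.Z) : Prop :=
  (∀ q : U × Euc m × Euc n → ℝ, (∃ K : ℝ≥0, LipschitzWith K q) →
    IsPiecewiseLipschitzNear (fun ζ => P.avg q (μ ζ) ζ) z) ∧
  IsPiecewiseLipschitzNear (fun ζ => P.avg P.g (μ ζ) ζ) z

/-- `L > 0` is a Lipschitz constant of `f(u, ·, ·)` on `Y × Z`, for all `u`. -/
def IsLipConstF (P : SPProblem U m n) (L : ℝ) : Prop :=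
  0 < L ∧ ∀ u, ∀ y ∈ P.Y, ∀ y' ∈ P.Y, ∀ z ∈ P.Z, ∀ z' ∈ P.Z,
    ‖P.f (u, y, z) - P.f (u, y', z')‖ ≤ L * (‖y - y'‖ + ‖z - z'‖)

/-- The step `Δ(ε) = ε / (2 L) * log (1 / ε)`. -/
def stepSize (L ε : ℝ) : ℝ := ε / (2 * L) * Real.log (1 / ε)

/-- `u` is the control constructed from the steering controls `us`, and `(y, z)` is the corresponding
solution of the singularly perturbed system: on each interval `[t_l, t_{l+1})`, `t_l = l Δ(ε)`,
`u(t)` is the control that steers the associated system with parameter `z(t_l)` from `y(t_l)`,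
run in the stretched time `(t - t_l) / ε`. -/
def IsConstructed (P : SPProblem U m n) (L : ℝ) (us : P.Y → P.Z → ℝ → U) (ε : ℝ)
    (u : ℝ → U) (y : ℝ → P.Y) (z : ℝ → P.Z) : Prop :=
  P.IsSPTriple ε u (fun t => (y t : Euc m)) (fun t => (z t : Euc n)) ∧
  ∀ l : ℕ, ∀ t ∈ Ico (l * stepSize L ε) ((l + 1) * stepSize L ε),
    u t = us (y (l * stepSize L ε)) (z (l * stepSize L ε)) ((t - l * stepSize L ε) / ε)

/-- For every `T > 0`, the slow trajectories `zε ε` lie, for small `ε`, in a tube around `z` in which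
the average of `g` is piecewise Lipschitz, except for times in small neighbourhoods (shrinking with
`ε`) of the exceptional points of the tube. -/
def StaysInTube (P : SPProblem U m n) (μ : P.Z → ProbabilityMeasure (U × P.Y)) (z : ℝ → P.Z)
    (zε : ℝ → ℝ → P.Z) : Prop :=
  ∀ T : ℝ, 0 < T → ∃ (s : Finset ℝ) (a : ℝ → ℝ),
    PiecewiseLipschitzTube (fun ζ => P.avg P.g (μ ζ) ζ) z T s a ∧
    ∃ δ : ℝ → ℝ, Tendsto δ (𝓝[>] 0) (𝓝 0) ∧
      ∀ᶠ ε in 𝓝[>] (0 : ℝ), 0 < δ ε ∧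
        ∀ t ∈ Icc 0 T, (∀ x ∈ s, t ∉ Ioo (x - δ ε) (x + δ ε)) →
          zε ε t ∈ Metric.ball (z t) (a t)

/-- The controls `u ε`, with the trajectories `(y ε, z ε)`, are asymptotically optimal. -/
def IsAsympOptimal (P : SPProblem U m n) (u : ℝ → ℝ → U) (y : ℝ → ℝ → P.Y) (z : ℝ → ℝ → P.Z) :
    Prop :=
  ∃ ℓ : ℝ,
    Tendsto (fun ε => P.cost (u ε) (fun t => (y ε t : Euc m)) (fun t => (z ε t : Euc n)))
      (𝓝[>] 0) (𝓝 ℓ) ∧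
    Tendsto P.value (𝓝[>] 0) (𝓝 ℓ)

/-- The controls `u ε`, with the trajectories `(y ε, z ε)`, are asymptotically `α`-near optimal. -/
def IsAsympNearOptimal (P : SPProblem U m n) (α : ℝ) (u : ℝ → ℝ → U) (y : ℝ → ℝ → P.Y)
    (z : ℝ → ℝ → P.Z) : Prop :=
  ∃ ℓ : ℝ,
    Tendsto (fun ε => P.cost (u ε) (fun t => (y ε t : Euc m)) (fun t => (z ε t : Euc n)))
      (𝓝[>] 0) (𝓝 ℓ) ∧
    ℓ ≤ liminf P.value (𝓝[>] 0) + α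

end SPProblem

end

/-! The optimal value is squeezed. Above it lie the costs of the constructed controls, which
converge to the averaged cost of the ACG family (`SPProblem.tendsto_cost_constructed`). Below it
lies, for small `ε`, every number less than `avgValue`. This is immediate if the values converge to
`avgValue`; if instead `C * avgValue = lpValue`, it follows from the averaged linear program
(`SPProblem.Standing.eventually_lt_cost`).

Upper bound. In the stretched time `(t - t_l) / ε` a step has length `S = Δ(ε) / ε`. Since `S → ∞`,
the steering control brings time averages close to those of `μ (z_ε(t_l))`, uniformly in the initial
state and the parameter. Freezing `z` during the step costs a drift of order `Δ(ε)`, which Grönwall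
multiplies by `S * exp (L * S)`; the choice of `Δ` makes `exp (L * S) = ε ^ (-1/2)`, so the product
still vanishes. Hence time integrals along the trajectory are close to integrals of averages sampled
at the times `t_l`. For `g` this compares `z_ε` with the averaged flow: the averaged field is
Lipschitz along the tube except near finitely many times, whose contribution disappears by dominated
convergence, and Grönwall gives `z_ε → z` uniformly on bounded intervals
(`SPProblem.eventually_norm_slow_sub_le`). For `G`, integration by parts transfers the estimate to
the discounted cost.

Lower bound. Discounted occupational measures of trajectories satisfy linear identities, obtained by
differentiating `φ(y) ψ(z)`. If costs stayed below the linear programming value along some `ε → 0`,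
a weak limit of these measures would satisfy the limit identities. Disintegrating it over `z` gives
conditional measures lying in `W(z)` almost everywhere, hence a feasible point of the averaged
program with too small a cost. -/

/-! ### Grönwall's inequality and Carathéodory solutions. -/

/-- Grönwall's inequality in integral form. -/
theorem le_mul_exp_of_le_add_integral {v : ℝ → ℝ} {E K T : ℝ} (hK : 0 ≤ K)
    (hv : ContinuousOn v (Icc 0 T))
    (h : ∀ t ∈ Icc 0 T, v t ≤ E + K * ∫ s in (0 : ℝ)..t, v s) :
    ∀ t ∈ Icc 0 T, v t ≤ E * Real.exp (K * t) := by
  intro t ht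
  have hT : (0 : ℝ) ≤ T := ht.1.trans ht.2
  -- Extending `v` continuously beyond `[0, T]` makes its primitive differentiable everywhere. The
  -- differential form of Grönwall is applied to this primitive, which starts at `0`, and the result
  -- is put back into `h`.
  set w : ℝ → ℝ := IccExtend hT ((Icc 0 T).domRestrict v) with hw
  have hwc : Continuous w := (continuousOn_iff_continuous_domRestrict.1 hv).Icc_extend'
  have hwv : ∀ s ∈ Icc 0 T, w s = v s := fun s hs => IccExtend_of_mem hT _ hs
  have hint : ∀ s ∈ Icc 0 T, ∫ r in (0 : ℝ)..s, w r = ∫ r in (0 : ℝ)..s, v r := fun s hs =>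
    intervalIntegral.integral_congr fun r hr => by
      rw [uIcc_of_le hs.1] at hr
      exact hwv r ⟨hr.1, hr.2.trans hs.2⟩
  have hd : ∀ s, HasDerivAt (fun r => ∫ x in (0 : ℝ)..r, w x) (w s) s := fun s =>
    hwc.integral_hasStrictDerivAt 0 s |>.hasDerivAt
  have hG := le_gronwallBound_of_liminf_deriv_right_le (f := fun r => ∫ x in (0 : ℝ)..r, w x)
    (f' := w) (δ := 0) (K := K) (ε := E) (a := 0) (b := T)
    (fun s _ => (hd s).continuousAt.continuousWithinAt)
    (fun s _ r hr => (hd s).hasDerivWithinAt.liminf_right_slope_le hr)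
    (by simp) (fun s hs => by
      have h1 := h s ⟨hs.1, hs.2.le⟩
      rw [hwv s ⟨hs.1, hs.2.le⟩, hint s ⟨hs.1, hs.2.le⟩]; linarith) t ht
  have h2 := h t ht
  rw [← hint t ht] at h2
  rcases hK.eq_or_lt with h0 | h0
  · subst h0; simpa using h2
  · rw [gronwallBound_of_K_ne_0 h0.ne'] at hG
    simp only [sub_zero, zero_mul, zero_add] at hG
    calc v t ≤ E + K * (E / K * (Real.exp (K * t) - 1)) := by
          refine h2.trans ?_; gcongr
      _ = E * Real.exp (K * t) := by field_simp; ring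

/-- Lebesgue differentiation on each `[0, N]`; countably many null sets are discarded. -/
theorem ae_hasDerivAt_integral_of_pos {E : Type*} [NormedAddCommGroup E] [NormedSpace ℝ E]
    [CompleteSpace E] {v : ℝ → E} (h : ∀ t : ℝ, 0 ≤ t → IntervalIntegrable v volume 0 t) :
    ∀ᵐ t, 0 < t → HasDerivAt (fun s => ∫ r in (0 : ℝ)..s, v r) (v t) t := by
  have h1 : ∀ N : ℕ, ∀ᵐ t, t ∈ uIcc (0 : ℝ) N → ∀ c ∈ uIcc (0 : ℝ) N,
      HasDerivAt (fun s => ∫ r in c..s, v r) (v t) t := fun N =>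
    (h N (Nat.cast_nonneg N)).ae_hasDerivAt_integral
  filter_upwards [ae_all_iff.2 h1] with t ht h0
  obtain ⟨N, hN⟩ := exists_nat_ge t
  exact ht N (by rw [uIcc_of_le (Nat.cast_nonneg N)]; exact ⟨h0.le, hN⟩) 0 left_mem_uIcc

namespace HasVelocity

variable {k : ℕ} {x v : ℝ → Euc k}

theorem intervalIntegrable (h : HasVelocity x v) {a b : ℝ} (ha : 0 ≤ a) (hb : 0 ≤ b) :
    IntervalIntegrable v volume a b :=
  (h a ha).1.symm.trans (h b hb).1

theorem sub_eq_integral (h : HasVelocity x v) {a b : ℝ} (ha : 0 ≤ a) (hb : 0 ≤ b) :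
    x b - x a = ∫ t in a..b, v t := by
  rw [(h a ha).2, (h b hb).2, ← intervalIntegral.integral_interval_sub_left (h b hb).1 (h a ha).1]
  abel

theorem norm_sub_le (h : HasVelocity x v) {M : ℝ} (hM : ∀ t, 0 ≤ t → ‖v t‖ ≤ M) {a b : ℝ}
    (ha : 0 ≤ a) (hb : 0 ≤ b) : ‖x b - x a‖ ≤ M * |b - a| := by
  rw [h.sub_eq_integral ha hb]
  refine intervalIntegral.norm_integral_le_of_norm_le_const fun t ht => hM t ?_
  exact (le_min ha hb).trans ht.1.le

theorem lipschitzOnWith (h : HasVelocity x v) {M : ℝ≥0} (hM : ∀ t, 0 ≤ t → ‖v t‖ ≤ M) :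
    LipschitzOnWith M x (Ici 0) :=
  LipschitzOnWith.of_dist_le_mul fun a ha b hb => by
    rw [dist_eq_norm, Real.dist_eq]; exact h.norm_sub_le hM hb ha

theorem continuousOn (h : HasVelocity x v) : ContinuousOn x (Ici 0) := by
  intro t ht
  have ht0 : (0 : ℝ) ≤ t := ht
  have h1 : ContinuousOn (fun s => x 0 + ∫ r in (0 : ℝ)..s, v r) (Icc 0 (t + 1)) := by
    refine continuousOn_const.add ?_
    have := intervalIntegral.continuousOn_primitive_interval' (h (t + 1) (by linarith)).1
      (left_mem_uIcc)
    rwa [uIcc_of_le (by linarith)] at this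
  have h2 : ContinuousOn x (Icc 0 (t + 1)) := h1.congr fun s hs => (h s hs.1).2
  refine (h2 t ⟨ht0, by linarith⟩).mono_of_mem_nhdsWithin ?_
  have : Icc 0 (t + 1) = Ici 0 ∩ Iic (t + 1) := rfl
  rw [this]
  exact inter_mem self_mem_nhdsWithin (mem_nhdsWithin_of_mem_nhds (Iic_mem_nhds (by linarith)))

theorem ae_hasDerivAt (h : HasVelocity x v) : ∀ᵐ t, 0 < t → HasDerivAt x (v t) t := by
  filter_upwards [ae_hasDerivAt_integral_of_pos fun t ht => (h t ht).1] with t ht h0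
  refine ((ht h0).const_add (x 0)).congr_of_eventuallyEq ?_
  filter_upwards [Ioi_mem_nhds h0] with s hs
  exact (h s (le_of_lt hs)).2

end HasVelocity

/-! ### Discounted integrals on the half line. -/

theorem integrableOn_exp_neg_mul {C : ℝ} (hC : 0 < C) :
    IntegrableOn (fun t => Real.exp (-(C * t))) (Ioi 0) := by
  simpa [neg_mul] using integrableOn_exp_mul_Ioi (neg_lt_zero.2 hC) 0

theorem integrableOn_mul_exp_neg_mul {C : ℝ} (hC : 0 < C) :
    IntegrableOn (fun t : ℝ => t * Real.exp (-(C * t))) (Ioi 0) := by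
  have := integrableOn_rpow_mul_exp_neg_mul_rpow (s := 1) (p := 1) (by norm_num) one_pos hC
  simpa [neg_mul] using this

theorem integrableOn_exp_neg_mul_of_bounded {C B : ℝ} (hC : 0 < C) {h : ℝ → ℝ}
    (hm : AEStronglyMeasurable h (volume.restrict (Ioi 0))) (hB : ∀ t, 0 < t → |h t| ≤ B) :
    IntegrableOn (fun t => Real.exp (-(C * t)) * h t) (Ioi 0) := by
  refine (integrableOn_exp_neg_mul hC).mul_bdd (c := B) hm ?_
  filter_upwards [ae_restrict_mem measurableSet_Ioi] with t ht
  simpa using hB t ht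

theorem integral_exp_neg_mul {C : ℝ} (hC : 0 < C) :
    ∫ t in Ioi (0 : ℝ), Real.exp (-(C * t)) = C⁻¹ := by
  have := integral_exp_mul_Ioi (neg_lt_zero.2 hC) 0
  simpa [neg_mul, neg_div, div_neg] using this

/-- The Laplace transform of the derivative of a Lipschitz function. -/
theorem integral_exp_neg_mul_deriv {C : ℝ} (hC : 0 < C) {F h : ℝ → ℝ} {K : ℝ≥0}
    (hF : LipschitzOnWith K F (Ici 0)) (hd : ∀ᵐ t, 0 < t → HasDerivAt F (h t) t)
    (hh : IntegrableOn (fun t => Real.exp (-(C * t)) * h t) (Ioi 0)) :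
    ∫ t in Ioi (0 : ℝ), Real.exp (-(C * t)) * h t
      = -F 0 + C * ∫ t in Ioi (0 : ℝ), Real.exp (-(C * t)) * F t := by
  have hbound : ∀ t, 0 ≤ t → |F t| ≤ |F 0| + K * t := by
    intro t ht
    have := hF.dist_le_mul t ht 0 self_mem_Ici
    rw [Real.dist_eq, Real.dist_eq, sub_zero, abs_of_nonneg ht] at this
    have h2 := abs_sub_abs_le_abs_sub (F t) (F 0)
    linarith
  have htend : Tendsto (fun T => Real.exp (-(C * T)) * F T) atTop (𝓝 0) := by
    have h1 : Tendsto (fun T : ℝ => |F 0| * Real.exp (-(C * T)) + K * (T * Real.exp (-(C * T))))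
        atTop (𝓝 0) := by
      have e1 : Tendsto (fun T : ℝ => Real.exp (-(C * T))) atTop (𝓝 0) :=
        Real.tendsto_exp_neg_atTop_nhds_zero.comp (tendsto_id.const_mul_atTop hC)
      have e2 : Tendsto (fun T : ℝ => T * Real.exp (-(C * T))) atTop (𝓝 0) := by
        have := (Real.tendsto_pow_mul_exp_neg_atTop_nhds_zero 1).comp
          (tendsto_id.const_mul_atTop hC)
        have := this.const_mul C⁻¹
        refine (this.congr fun T => ?_).trans_eq (by simp) |>.trans le_rfl
        simp; field_simp
      simpa using (e1.const_mul |F 0|).add (e2.const_mul (K : ℝ))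
    refine squeeze_zero_norm' ?_ h1
    filter_upwards [eventually_ge_atTop 0] with T hT
    rw [Real.norm_eq_abs, abs_mul, abs_of_pos (Real.exp_pos _)]
    have := mul_le_mul_of_nonneg_left (hbound T hT) (Real.exp_pos (-(C * T))).le
    linarith
  have hFi : IntegrableOn (fun t => Real.exp (-(C * t)) * F t) (Ioi 0) := by
    have hm : AEStronglyMeasurable F (volume.restrict (Ioi 0)) :=
      (hF.continuousOn.mono Ioi_subset_Ici_self).aestronglyMeasurable measurableSet_Ioi
    refine Integrable.mono' (((integrableOn_exp_neg_mul hC).const_mul |F 0|).add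
      ((integrableOn_mul_exp_neg_mul hC).const_mul (K : ℝ)))
      ((by fun_prop : Continuous fun t : ℝ => Real.exp (-(C * t))).aestronglyMeasurable.mul hm) ?_
    filter_upwards [ae_restrict_mem measurableSet_Ioi] with t ht
    rw [Real.norm_eq_abs, abs_mul, abs_of_pos (Real.exp_pos _)]
    have := mul_le_mul_of_nonneg_left (hbound t (le_of_lt ht)) (Real.exp_pos (-(C * t))).le
    simp only [Pi.add_apply]
    linarith
  -- The fundamental theorem of calculus for the absolutely continuous function `exp (-C t) * F t`.
  -- Letting `T → ∞` finishes the proof, since `F` grows at most linearly.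
  have hfin : ∀ T : ℝ, 0 ≤ T →
      ∫ t in (0 : ℝ)..T, (Real.exp (-(C * t)) * h t - C * (Real.exp (-(C * t)) * F t))
        = Real.exp (-(C * T)) * F T - F 0 := by
    intro T hT
    have hac : AbsolutelyContinuousOnInterval (fun t => Real.exp (-(C * t)) * F t) 0 T := by
      refine AbsolutelyContinuousOnInterval.mul ?_ ?_
      · exact ContDiffOn.absolutelyContinuousOnInterval (by fun_prop)
      · refine (hF.mono ?_).absolutelyContinuousOnInterval
        rw [uIcc_of_le hT]; exact Icc_subset_Ici_self
    have := hac.integral_deriv_eq_sub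
    simp only [mul_zero, neg_zero, Real.exp_zero, one_mul] at this
    rw [← this]
    refine intervalIntegral.integral_congr_ae ?_
    filter_upwards [hd] with t ht htT
    rw [uIoc_of_le hT] at htT
    have he : HasDerivAt (fun t => Real.exp (-(C * t))) (Real.exp (-(C * t)) * -(C * 1)) t :=
      (((hasDerivAt_id t).const_mul C).neg).exp
    have h2 : HasDerivAt (fun t => Real.exp (-(C * t)) * F t) _ t := he.mul (ht htT.1)
    rw [h2.deriv]; ring
  have hI := intervalIntegral_tendsto_integral_Ioi 0 (hh.sub (hFi.const_mul C)) tendsto_id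
  have hI2 : Tendsto (fun T : ℝ => ∫ t in (0 : ℝ)..T,
      (Real.exp (-(C * t)) * h t - C * (Real.exp (-(C * t)) * F t))) atTop (𝓝 (0 - F 0)) := by
    refine (htend.sub_const (F 0)).congr' ?_
    filter_upwards [eventually_ge_atTop 0] with T hT
    exact (hfin T hT).symm
  have := tendsto_nhds_unique hI hI2
  rw [integral_sub' hh (hFi.const_mul C), integral_const_mul] at this
  linarith

/-- Continuous functions are uniform limits of Lipschitz functions on compact sets. -/
theorem IsCompact.exists_lipschitzWith_abs_sub_le {X : Type*} [PseudoMetricSpace X] {s : Set X}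
    (hs : IsCompact s) {q : X → ℝ} (hq : Continuous q) {η : ℝ} (hη : 0 < η) :
    ∃ (K : ℝ≥0) (p : X → ℝ), LipschitzWith K p ∧ ∀ x ∈ s, |p x - q x| ≤ η := by
  rcases s.eq_empty_or_nonempty with rfl | hne
  · exact ⟨0, fun _ => 0, LipschitzWith.const 0, by simp⟩
  have : Nonempty s := hne.to_subtype
  obtain ⟨B, hB⟩ := hs.exists_bound_of_continuousOn hq.continuousOn
  obtain ⟨x0, hx0⟩ := hne
  have hB0 : 0 ≤ B := (norm_nonneg _).trans (hB x0 hx0)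
  obtain ⟨δ, hδ, hu⟩ := Metric.uniformContinuousOn_iff.1
    (hs.uniformContinuousOn_of_continuous hq.continuousOn) η hη
  -- The approximant is the infimal convolution `⨅ y, q y + k * dist x y`. With slope `2 * B / δ`,
  -- points `y` at distance at least `δ` cost at least `2 * B` more than `q y`, so they cannot bring
  -- the infimum below `q x`; nearer points are handled by uniform continuity.
  set k : ℝ≥0 := ⟨2 * B / δ, by positivity⟩ with hk
  have hkδ : (k : ℝ) * δ = 2 * B := by
    change 2 * B / δ * δ = _
    field_simp
  have hbdd : ∀ x : X, BddBelow (range fun y : s => q y + k * dist x (y : X)) := fun x =>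
    ⟨-B, by
      rintro _ ⟨y, rfl⟩
      have := (abs_le.1 (hB y y.2)).1
      have : 0 ≤ (k : ℝ) * dist x y := by positivity
      simp only; linarith⟩
  refine ⟨k, fun x => ⨅ y : s, q y + k * dist x y, LipschitzWith.of_le_add_mul k ?_, ?_⟩
  · intro x x'
    rw [← sub_le_iff_le_add]
    refine le_ciInf fun y => ?_
    rw [sub_le_iff_le_add]
    refine (ciInf_le (hbdd x) y).trans ?_
    have := mul_le_mul_of_nonneg_left (dist_triangle x x' y) k.coe_nonneg
    linarith
  · intro x hx
    rw [abs_le]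
    constructor
    · rw [le_sub_iff_add_le, neg_add_eq_sub]
      refine le_ciInf fun y => ?_
      by_cases hxy : dist x y < δ
      · have := hu x hx y y.2 hxy
        rw [Real.dist_eq] at this
        have := (abs_lt.1 this).2
        have : 0 ≤ (k : ℝ) * dist x y := by positivity
        linarith
      · have h1 := mul_le_mul_of_nonneg_left (not_lt.1 hxy) k.coe_nonneg
        rw [hkδ] at h1
        have h2 := (abs_le.1 (hB y y.2)).1
        have h3 := (abs_le.1 (hB x hx)).2
        linarith
    · have := ciInf_le (hbdd x) ⟨x, hx⟩
      simp only [dist_self, mul_zero, add_zero] at this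
      linarith

/-! ### Occupational measures and the metric `ρ`. -/

section Occupational

variable {W : Type*} [MeasurableSpace W]

/-- After division by `N` the function `k` lies in the unit ball, so one test function `q l`
approximates `k / N`. The series `ρ` dominates its `l`-th term, and undoing the weight and the
scaling gives `B = N * 2 ^ (l + 1)`. -/
theorem IsTestSequence.abs_integral_sub_integral_le [MetricSpace W] [CompactSpace W] [BorelSpace W]
    {q : ℕ → W → ℝ} (hq : IsTestSequence q)
    {k : W → ℝ} (hk : Continuous k) {η : ℝ} (hη : 0 < η) :
    ∃ B : ℝ, 0 ≤ B ∧ ∀ γ γ' : Measure W, IsProbabilityMeasure γ → IsProbabilityMeasure γ' →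
      |(∫ w, k w ∂γ) - ∫ w, k w ∂γ'| ≤ η + B * rhoDist q γ γ' := by
  obtain ⟨B0, hB0⟩ := isCompact_univ.exists_bound_of_continuousOn hk.continuousOn
  set N : ℝ := |B0| + 1 with hN
  have hNpos : 0 < N := by positivity
  obtain ⟨l, hl⟩ := hq.2.2 (fun w => k w / N) (hk.div_const N) (fun w => by
    rw [abs_div, abs_of_pos hNpos, div_le_one hNpos]
    have := hB0 w (mem_univ w)
    rw [Real.norm_eq_abs] at this
    have := le_abs_self B0
    linarith) (η / (2 * N)) (by positivity)
  have hqc : ∀ j, Continuous (q j) := fun j => let ⟨_, hK⟩ := hq.1 j; hK.continuous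
  refine ⟨N * 2 ^ (l + 1), by positivity, fun γ γ' hγ hγ' => ?_⟩
  have hint : ∀ (ν : Measure W) [IsProbabilityMeasure ν] (j : W → ℝ), Continuous j →
      Integrable j ν := fun ν _ j hj => hj.integrable_of_hasCompactSupport
        (HasCompactSupport.of_compactSpace j)
  have happ : ∀ ν : Measure W, IsProbabilityMeasure ν →
      |(∫ w, k w ∂ν) - N * ∫ w, q l w ∂ν| ≤ η / 2 := by
    intro ν hν
    rw [← integral_const_mul, ← integral_sub (hint ν _ hk) ((hint ν _ (hqc l)).const_mul N)]
    have := norm_integral_le_of_norm_le_const (μ := ν) (f := fun w => k w - N * q l w) (C := η / 2)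
      (Eventually.of_forall fun w => by
        have h1 := mul_le_mul_of_nonneg_left (hl w) hNpos.le
        rw [Real.norm_eq_abs]
        have h2 : |k w - N * q l w| = N * |q l w - k w / N| := by
          rw [← abs_of_pos hNpos, ← abs_mul, abs_of_pos hNpos, abs_sub_comm]
          congr 1; field_simp
        rw [h2]
        refine h1.trans_eq ?_
        field_simp)
    simpa using this
  have hterm : (1 / 2 : ℝ) ^ (l + 1) * |(∫ w, q l w ∂γ) - ∫ w, q l w ∂γ'| ≤ rhoDist q γ γ' := by
    refine Summable.le_tsum (f := fun l : ℕ => (1 / 2 : ℝ) ^ (l + 1) *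
      |(∫ w, q l w ∂γ) - ∫ w, q l w ∂γ'|) ?_ l (fun j _ => by positivity)
    have hb : ∀ (ν : Measure W), IsProbabilityMeasure ν → ∀ j, |∫ w, q j w ∂ν| ≤ 1 := by
      intro ν hν j
      have := norm_integral_le_of_norm_le_const (μ := ν) (f := q j) (C := 1)
        (Eventually.of_forall fun w => hq.2.1 j w)
      simpa using this
    refine Summable.of_nonneg_of_le (fun j => by positivity) (fun j => ?_)
      (summable_geometric_two.mul_right 1)
    have h1 := abs_sub (∫ w, q j w ∂γ) (∫ w, q j w ∂γ')
    have h2 := hb γ hγ j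
    have h3 := hb γ' hγ' j
    rw [pow_succ, mul_assoc]
    gcongr
    linarith
  have h1 := happ γ hγ
  have h2 := happ γ' hγ'
  have h3 : N * |(∫ w, q l w ∂γ) - ∫ w, q l w ∂γ'| ≤ N * 2 ^ (l + 1) * rhoDist q γ γ' := by
    rw [mul_assoc]
    gcongr
    calc _ = 2 ^ (l + 1) * ((1 / 2 : ℝ) ^ (l + 1) * |(∫ w, q l w ∂γ) - ∫ w, q l w ∂γ'|) := by
          rw [← mul_assoc, ← mul_pow]; norm_num
      _ ≤ _ := by gcongr
  have h4 : |N * (∫ w, q l w ∂γ) - N * ∫ w, q l w ∂γ'|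
      = N * |(∫ w, q l w ∂γ) - ∫ w, q l w ∂γ'| := by
    rw [← mul_sub, abs_mul, abs_of_pos hNpos]
  rw [abs_le] at h1 h2 ⊢
  have h5 := abs_le.1 (h4.le.trans h3)
  constructor <;> linarith

theorem isProbabilityMeasure_occupOn {w : ℝ → W} {S : ℝ} (hS : 0 < S)
    (hw : AEMeasurable w (volume.restrict (Icc 0 S))) : IsProbabilityMeasure (occupOn w S) := by
  refine ⟨?_⟩
  rw [occupOn, Measure.smul_apply, Measure.map_apply_of_aemeasurable hw MeasurableSet.univ]
  simp only [preimage_univ, Measure.restrict_apply MeasurableSet.univ, univ_inter, Real.volume_Icc,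
    sub_zero, smul_eq_mul]
  exact ENNReal.inv_mul_cancel (by simpa using hS) ENNReal.ofReal_ne_top

theorem integral_occupOn [MetricSpace W] [BorelSpace W] {w : ℝ → W} {S : ℝ} (hS : 0 < S)
    (hw : AEMeasurable w (volume.restrict (Icc 0 S))) {k : W → ℝ} (hk : Continuous k) :
    ∫ x, k x ∂(occupOn w S) = S⁻¹ * ∫ t in (0 : ℝ)..S, k (w t) := by
  rw [occupOn, integral_smul_measure, integral_map hw hk.aestronglyMeasurable,
    intervalIntegral.integral_of_le hS.le, integral_Icc_eq_integral_Ioc, ENNReal.toReal_inv,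
    ENNReal.toReal_ofReal hS.le, smul_eq_mul]

end Occupational

/-! ### Steering in the associated system, and the fast motion during one step. -/

theorem HasVelocity.comp_add_mul {k : ℕ} {x v : ℝ → Euc k} (h : HasVelocity x v) {a c : ℝ}
    (ha : 0 ≤ a) (hc : 0 < c) :
    HasVelocity (fun t => x (a + c * t)) (fun t => c • v (a + c * t)) := by
  intro t ht
  have hat : 0 ≤ a + c * t := by positivity
  constructor
  · have h1 : IntervalIntegrable (fun t => v (a + c * t)) volume 0 t := by
      simpa [mul_div_cancel_left₀ _ hc.ne'] using
        ((h.intervalIntegrable ha hat).comp_add_left a).comp_mul_left (c := c)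
    exact h1.smul c
  · rw [intervalIntegral.integral_smul, intervalIntegral.smul_integral_comp_add_mul, mul_zero,
      add_zero, ← h.sub_eq_integral ha hat]
    simp

namespace SPProblem

variable {U : Type*} {m n : ℕ} [MetricSpace U] [MeasurableSpace U] {P : SPProblem U m n}

theorem Standing.isCompact_prod [CompactSpace U] (hP : P.Standing) :
    IsCompact ((univ : Set U) ×ˢ P.Y ×ˢ P.Z) :=
  isCompact_univ.prod (hP.Y_compact.prod hP.Z_compact)

theorem Standing.exists_norm_le [CompactSpace U] (hP : P.Standing) {V : Type*}
    [NormedAddCommGroup V] {h : U × Euc m × Euc n → V} (hh : Continuous h) :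
    ∃ B : ℝ≥0, ∀ u, ∀ y ∈ P.Y, ∀ z ∈ P.Z, ‖h (u, y, z)‖ ≤ B := by
  obtain ⟨B, hB⟩ := hP.isCompact_prod.exists_bound_of_continuousOn hh.continuousOn
  exact ⟨B.toNNReal, fun u y hy z hz =>
    (hB (u, y, z) ⟨mem_univ _, hy, hz⟩).trans (Real.le_coe_toNNReal B)⟩

theorem Standing.compactSpace_Y (hP : P.Standing) : CompactSpace P.Y :=
  isCompact_iff_compactSpace.1 hP.Y_compact

theorem Standing.compactSpace_Z (hP : P.Standing) : CompactSpace P.Z :=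
  isCompact_iff_compactSpace.1 hP.Z_compact

theorem IsAssocAdmissible.aemeasurable [BorelSpace U] {ζ : P.Z} {u : ℝ → U}
    {y : ℝ → P.Y} (h : P.IsAssocAdmissible ζ u y) :
    AEMeasurable (fun τ => (u τ, y τ)) (volume.restrict (Ici 0)) := by
  refine h.1.aemeasurable.prodMk ?_
  have := h.2.continuousOn
  have h2 : ContinuousOn y (Ici 0) := continuousOn_iff_continuous_domRestrict.2
    (Continuous.subtype_mk (continuousOn_iff_continuous_domRestrict.1 this) fun t => (y t).2)
  exact h2.aemeasurable measurableSet_Ici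

/-- Along the steering controls, time averages converge uniformly in the initial state and in the
parameter. -/
theorem IsUniformSteering.eventually_abs_average_sub_le [CompactSpace U] [BorelSpace U]
    (hP : P.Standing) {q : ℕ → U × P.Y → ℝ} (hq : IsTestSequence q)
    {μ : P.Z → ProbabilityMeasure (U × P.Y)} {us : P.Y → P.Z → ℝ → U} {ys : P.Y → P.Z → ℝ → P.Y}
    (hs : P.IsUniformSteering q μ us ys) {p : U × Euc m × Euc n → ℝ} (hp : Continuous p)
    {η : ℝ} (hη : 0 < η) :
    ∀ᶠ S in atTop, ∀ y ζ,
      |(S⁻¹ * ∫ τ in (0 : ℝ)..S, p (us y ζ τ, ys y ζ τ, ζ)) - P.avg p (μ ζ) ζ| ≤ η := by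
  have := hP.compactSpace_Y
  have := hP.compactSpace_Z
  obtain ⟨hadm, φ, hφ, hρ⟩ := hs
  -- Continuity of `ζ ↦ p(·, ·, ζ)` in the sup norm and compactness of `Z` reduce the claim to
  -- finitely many test functions `H ζ0`. No continuity of `μ` in `ζ` is needed, because `ρ`
  -- controls the distance to `μ ζ` uniformly in `ζ`. The error is four quarters of `η`: replacing
  -- `H ζ` by `H ζ0` under each of the two measures, the approximation by a test function, and `B *
  -- φ S`.
  let H : C(P.Z, C(U × P.Y, ℝ)) := ContinuousMap.curry
    ⟨fun x : P.Z × (U × P.Y) => p (x.2.1, x.2.2, x.1), by fun_prop⟩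
  suffices ∀ᶠ S in atTop, ∀ ζ ∈ (univ : Set P.Z), ∀ y,
      |(S⁻¹ * ∫ τ in (0 : ℝ)..S, p (us y ζ τ, ys y ζ τ, ζ)) - P.avg p (μ ζ) ζ| ≤ η by
    filter_upwards [this] with S hS y ζ using hS ζ (mem_univ _) y
  refine isCompact_univ.induction_on (p := fun s => ∀ᶠ S in atTop, ∀ ζ ∈ s, ∀ y,
      |(S⁻¹ * ∫ τ in (0 : ℝ)..S, p (us y ζ τ, ys y ζ τ, ζ)) - P.avg p (μ ζ) ζ| ≤ η)
    (by simp) (fun s t hst ht => ht.mono fun S hS ζ hζ => hS ζ (hst hζ))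
    (fun s t hs ht => ?_) (fun ζ0 _ => ?_)
  · filter_upwards [hs, ht] with S h1 h2 ζ hζ
    exact hζ.elim (h1 ζ) (h2 ζ)
  · obtain ⟨B, hB, hBk⟩ := hq.abs_integral_sub_integral_le (H ζ0).continuous (half_pos (half_pos hη))
    refine ⟨{ζ | dist (H ζ) (H ζ0) < η / 4}, mem_nhdsWithin_of_mem_nhds
      (H.continuous.tendsto ζ0 (Metric.ball_mem_nhds _ (by positivity))), ?_⟩
    have hφB : ∀ᶠ S in atTop, B * φ S < η / 4 :=
      (hφ.const_mul B).eventually_lt_const (by rw [mul_zero]; positivity)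
    filter_upwards [hφB, eventually_gt_atTop 0] with S hS hS0 ζ hζ y
    have hw := ((hadm y ζ).1.aemeasurable).mono_measure
      (Measure.restrict_mono (Icc_subset_Ici_self : Icc 0 S ⊆ Ici 0) le_rfl)
    have := isProbabilityMeasure_occupOn hS0 hw
    have hpr : ∀ ν : Measure (U × P.Y), IsProbabilityMeasure ν →
        |(∫ w, H ζ w ∂ν) - ∫ w, H ζ0 w ∂ν| ≤ η / 4 := by
      intro ν hν
      have hi : ∀ j : C(U × P.Y, ℝ), Integrable j ν := fun j =>
        j.continuous.integrable_of_hasCompactSupport (HasCompactSupport.of_compactSpace j)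
      rw [← integral_sub (hi _) (hi _)]
      have := norm_integral_le_of_norm_le_const (μ := ν) (f := fun w => H ζ w - H ζ0 w)
        (C := η / 4) (Eventually.of_forall fun w => by
          rw [← dist_eq_norm]
          exact (ContinuousMap.dist_apply_le_dist w).trans (le_of_lt hζ))
      simpa using this
    have e1 := hpr _ this
    have e2 := hpr (μ ζ : Measure (U × P.Y)) inferInstance
    have e3 := hBk _ (μ ζ : Measure (U × P.Y)) this inferInstance
    have e4 := mul_le_mul_of_nonneg_left (hρ S hS0 y ζ) hB
    have e5 := integral_occupOn hS0 hw (H ζ).continuous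
    have e6 : (∫ w, H ζ w ∂(μ ζ : Measure (U × P.Y))) = P.avg p (μ ζ) ζ := rfl
    have e7 : (∫ τ in (0 : ℝ)..S, H ζ (us y ζ τ, ys y ζ τ))
      = ∫ τ in (0 : ℝ)..S, p (us y ζ τ, ys y ζ τ, ζ) := rfl
    rw [e7] at e5
    rw [← e5, ← e6]
    rw [abs_le] at e1 e2 e3 ⊢
    constructor <;> linarith

omit [MetricSpace U] in
/-- On each step the constructed fast trajectory stays close to the steered one. -/
theorem IsConstructed.norm_fast_sub_le {q : ℕ → U × P.Y → ℝ}
    {μ : P.Z → ProbabilityMeasure (U × P.Y)} {us : P.Y → P.Z → ℝ → U} {ys : P.Y → P.Z → ℝ → P.Y}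
    (hs : P.IsUniformSteering q μ us ys) {L : ℝ} (hL : P.IsLipConstF L) {M : ℝ≥0}
    (hM : ∀ u, ∀ y ∈ P.Y, ∀ z ∈ P.Z, ‖P.g (u, y, z)‖ ≤ M) {ε : ℝ} (hε : 0 < ε)
    (hΔ : 0 < stepSize L ε) {u : ℝ → U} {y : ℝ → P.Y} {z : ℝ → P.Z}
    (hc : P.IsConstructed L us ε u y z) (l : ℕ) :
    ∀ τ ∈ Icc 0 (stepSize L ε / ε),
      ‖(y (l * stepSize L ε + ε * τ) : Euc m)
        - ys (y (l * stepSize L ε)) (z (l * stepSize L ε)) τ‖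
      ≤ L * (M * stepSize L ε) * (stepSize L ε / ε) * Real.exp (L * (stepSize L ε / ε)) := by
  set D := stepSize L ε with hD
  set S := D / ε with hS
  set y0 := y (l * D) with hy0
  set ζ := z (l * D) with hζ
  have hεS : ε * S = D := by rw [hS]; field_simp
  have hS0 : 0 < S := by positivity
  have hl0 : 0 ≤ l * D := by positivity
  obtain ⟨⟨hum, -, -, hyv, hzv⟩, hus⟩ := hc
  obtain ⟨⟨-, hysv⟩, hys0⟩ := hs.1 y0 ζ
  have hyv' := hyv.comp_add_mul hl0 hε
  have hcont : ContinuousOn (fun τ => ‖(y (l * D + ε * τ) : Euc m) - ys y0 ζ τ‖) (Icc 0 S) :=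
    (hyv'.continuousOn.sub hysv.continuousOn).norm.mono Icc_subset_Ici_self
  have hzb : ∀ τ ∈ Icc 0 S, ‖(z (l * D + ε * τ) : Euc n) - ζ‖ ≤ M * D := by
    intro τ hτ
    have h0 : 0 ≤ ε * τ := mul_nonneg hε.le hτ.1
    refine (hzv.norm_sub_le (M := M) (fun t _ => hM _ _ (y t).2 _ (z t).2) hl0
      (by positivity)).trans ?_
    rw [add_sub_cancel_left, abs_of_nonneg h0, ← hεS]
    have := hτ.2
    gcongr
  -- In stretched time both fast trajectories start at `y0` under the same control. The velocities
  -- differ by at most `L` times the current distance plus the slow drift `M * D`, whose integral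
  -- over the step gives the constant `E`.
  have hineq := le_mul_exp_of_le_add_integral hL.1.le hcont (E := L * (M * D) * S) ?_
  · intro τ hτ
    refine (hineq τ hτ).trans ?_
    have := hτ.2
    have := hL.1
    gcongr
  intro τ hτ
  have e1 := (hyv' τ hτ.1)
  have e2 := (hysv τ hτ.1)
  simp only [mul_zero, add_zero] at e1
  simp only at e2
  rw [e1.2, e2.2, hys0, ← hy0, add_sub_add_left_eq_sub, ← intervalIntegral.integral_sub e1.1 e2.1]
  have hci : IntervalIntegrable (fun σ => ‖(y (l * D + ε * σ) : Euc m) - ys y0 ζ σ‖)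
      volume 0 τ := by
    refine ContinuousOn.intervalIntegrable ?_
    rw [uIcc_of_le hτ.1]
    exact hcont.mono (Icc_subset_Icc_right hτ.2)
  have hb : ‖∫ σ in (0 : ℝ)..τ, (ε • ε⁻¹ • P.f (u (l * D + ε * σ), (y (l * D + ε * σ) : Euc m),
      (z (l * D + ε * σ) : Euc n)) - P.f (us y0 ζ σ, (ys y0 ζ σ : Euc m), (ζ : Euc n)))‖
      ≤ ∫ σ in (0 : ℝ)..τ, (L * ‖(y (l * D + ε * σ) : Euc m) - ys y0 ζ σ‖ + L * (M * D)) := by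
    refine intervalIntegral.norm_integral_le_of_norm_le hτ.1 ?_
      ((hci.const_mul L).add intervalIntegrable_const)
    -- The control is prescribed on a half-open step, so the right endpoint is excluded as a null
    -- set.
    filter_upwards [compl_mem_ae_iff.2 (measure_singleton S)] with σ hσS hσ
    have hσ' : σ < S := lt_of_le_of_ne (hσ.2.trans hτ.2) hσS
    have hlt : ε * σ < D := by rw [← hεS]; gcongr
    have hu : u (l * D + ε * σ) = us y0 ζ σ := by
      rw [hus l (l * D + ε * σ) ⟨by nlinarith [hσ.1], by nlinarith⟩, add_sub_cancel_left,
        mul_div_cancel_left₀ _ hε.ne']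
    rw [smul_smul, mul_inv_cancel₀ hε.ne', one_smul, hu]
    refine (hL.2 _ _ (y _).2 _ (ys _ _ _).2 _ (z _).2 _ ζ.2).trans ?_
    rw [← mul_add]
    have := hzb σ ⟨hσ.1.le, hσ'.le⟩
    have := hL.1
    gcongr
  refine hb.trans ?_
  rw [intervalIntegral.integral_add (hci.const_mul L) intervalIntegrable_const,
    intervalIntegral.integral_const_mul, intervalIntegral.integral_const, sub_zero, smul_eq_mul,
    add_comm, mul_comm τ]
  have := hτ.2
  have := hL.1
  gcongr

end SPProblem

/-! ### Integrals over successive steps and sampling times. -/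

theorem intervalIntegrable_of_norm_le {E : Type*} [NormedAddCommGroup E] {F : ℝ → E} {B : ℝ}
    (hm : AEStronglyMeasurable F (volume.restrict (Ici 0))) (hB : ∀ t, 0 ≤ t → ‖F t‖ ≤ B)
    {a b : ℝ} (ha : 0 ≤ a) (hb : 0 ≤ b) : IntervalIntegrable F volume a b := by
  have hsub : uIoc a b ⊆ Ici 0 := fun t ht => (le_min ha hb).trans ht.1.le
  refine (intervalIntegrable_const (c := B)).mono_fun
    (hm.mono_measure (Measure.restrict_mono hsub le_rfl)) ?_
  filter_upwards [ae_restrict_mem measurableSet_uIoc] with t ht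
  exact (hB t (hsub ht)).trans (le_abs_self B)

theorem EuclideanSpace.norm_le_sum_abs {k : ℕ} (x : EuclideanSpace ℝ (Fin k)) :
    ‖x‖ ≤ ∑ i, |x i| := by
  conv_lhs => rw [← (EuclideanSpace.basisFun (Fin k) ℝ).sum_repr x]
  refine (norm_sum_le _ _).trans (Finset.sum_le_sum fun i _ => ?_)
  rw [norm_smul]
  simp

/-- A function that is small on average over every step has a slowly growing integral. -/
theorem abs_integral_le_of_steps {H : ℝ → ℝ} {B η D : ℝ} (hη : 0 ≤ η) (hD : 0 < D)
    (hH : AEStronglyMeasurable H (volume.restrict (Ici 0))) (hB : ∀ t, 0 ≤ t → |H t| ≤ B)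
    (hstep : ∀ l : ℕ, |∫ t in (l * D)..((l + 1) * D), H t| ≤ η * D) {t : ℝ} (ht : 0 ≤ t) :
    |∫ s in (0 : ℝ)..t, H s| ≤ η * t + B * D := by
  have hi : ∀ {a b : ℝ}, 0 ≤ a → 0 ≤ b → IntervalIntegrable H volume a b :=
    intervalIntegrable_of_norm_le hH hB
  -- The `N` complete steps contribute `η * D` each; the incomplete last one is estimated only by `B
  -- * D`.
  set N := ⌊t / D⌋₊ with hN
  have hND : N * D ≤ t := by
    rw [← le_div_iff₀ hD]; exact Nat.floor_le (by positivity)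
  have hND' : t < (N + 1) * D := by
    rw [← div_lt_iff₀ hD]; exact Nat.lt_floor_add_one _
  have h0 : (0 : ℝ) ≤ N * D := by positivity
  have hB0 : 0 ≤ B := (abs_nonneg _).trans (hB 0 le_rfl)
  have hsum := intervalIntegral.sum_integral_adjacent_intervals (f := H) (μ := volume)
    (a := fun l : ℕ => (l : ℝ) * D) (n := N) (fun k _ => hi (by positivity) (by positivity))
  simp only [Nat.cast_zero, zero_mul] at hsum
  have h1 : |∫ s in (0 : ℝ)..(N * D), H s| ≤ η * (N * D) := by
    rw [← hsum]
    refine (Finset.abs_sum_le_sum_abs _ _).trans ?_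
    calc _ ≤ ∑ _k ∈ Finset.range N, η * D := Finset.sum_le_sum fun k _ => by
          have := hstep k
          push_cast
          exact this
      _ = _ := by simp; ring
  have h2 : |∫ s in (N * D)..t, H s| ≤ B * (t - N * D) := by
    have := intervalIntegral.norm_integral_le_of_norm_le_const (a := N * D) (b := t) (f := H)
      (C := B) (fun s hs => hB s (by
        rw [uIoc_of_le hND] at hs; exact h0.trans hs.1.le))
    rwa [abs_of_nonneg (by linarith)] at this
  rw [← intervalIntegral.integral_add_adjacent_intervals (hi le_rfl h0) (hi h0 ht)]
  refine (abs_add_le _ _).trans (add_le_add (h1.trans (by gcongr)) (h2.trans ?_))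
  gcongr
  linarith

/-- The last sampling time `l * D` before `s`. -/
noncomputable def sampleTime (D s : ℝ) : ℝ := ⌊s / D⌋₊ * D

theorem sampleTime_nonneg {D : ℝ} (hD : 0 < D) (s : ℝ) : 0 ≤ sampleTime D s := by
  unfold sampleTime; positivity

theorem sampleTime_le {D s : ℝ} (hD : 0 < D) (hs : 0 ≤ s) : sampleTime D s ≤ s := by
  rw [sampleTime, ← le_div_iff₀ hD]; exact Nat.floor_le (by positivity)

theorem lt_sampleTime_add {D : ℝ} (hD : 0 < D) (s : ℝ) : s < sampleTime D s + D := by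
  have : s < (⌊s / D⌋₊ + 1) * D := by rw [← div_lt_iff₀ hD]; exact Nat.lt_floor_add_one _
  rw [sampleTime]; linarith

theorem abs_sub_sampleTime_le {D s : ℝ} (hD : 0 < D) (hs : 0 ≤ s) : |s - sampleTime D s| ≤ D := by
  rw [abs_of_nonneg (by linarith [sampleTime_le hD hs])]
  linarith [lt_sampleTime_add hD s]

theorem sampleTime_eq {D s : ℝ} (hD : 0 < D) {l : ℕ} (hs : s ∈ Ico (l * D) ((l + 1) * D)) :
    sampleTime D s = l * D := by
  have : ⌊s / D⌋₊ = l := by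
    rw [Nat.floor_eq_iff (div_nonneg (le_trans (by positivity) hs.1) hD.le)]
    exact ⟨(le_div_iff₀ hD).2 hs.1, (div_lt_iff₀ hD).2 hs.2⟩
  rw [sampleTime, this]

/-- Sampling times form a countable set, so `c` needs no regularity. This gives measurability of
sampled averages although `μ` is not assumed measurable in `ζ`. -/
theorem stronglyMeasurable_comp_sampleTime {E : Type*} [TopologicalSpace E]
    [TopologicalSpace.PseudoMetrizableSpace E] [SecondCountableTopology E] [MeasurableSpace E]
    [BorelSpace E] (c : ℝ → E) (D : ℝ) : StronglyMeasurable fun s => c (sampleTime D s) := by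
  have h1 : Measurable fun l : ℕ => c (l * D) := measurable_from_top
  exact (h1.comp (Nat.measurable_floor.comp (measurable_id.div_const D))).stronglyMeasurable

namespace SPProblem

variable {U : Type*} {m n : ℕ} [MetricSpace U] [MeasurableSpace U] {P : SPProblem U m n}

/-! ### Asymptotics of the step size. -/

section StepSize

variable {L : ℝ}

theorem tendsto_log_one_div : Tendsto (fun ε : ℝ => Real.log (1 / ε)) (𝓝[>] 0) atTop := by
  simp only [one_div]
  exact Real.tendsto_log_atTop.comp tendsto_inv_nhdsGT_zero

theorem tendsto_stepSize_div (hL : 0 < L) :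
    Tendsto (fun ε => stepSize L ε / ε) (𝓝[>] 0) atTop := by
  have h := tendsto_log_one_div.const_mul_atTop (show 0 < 1 / (2 * L) by positivity)
  refine h.congr' ?_
  filter_upwards [self_mem_nhdsWithin] with ε hε
  have : ε ≠ 0 := ne_of_gt hε
  rw [stepSize]; field_simp

theorem eventually_stepSize_pos (hL : 0 < L) : ∀ᶠ ε in 𝓝[>] (0 : ℝ), 0 < stepSize L ε := by
  filter_upwards [self_mem_nhdsWithin, tendsto_log_one_div.eventually_gt_atTop 0] with ε h0 h1
  have : 0 < ε := h0
  unfold stepSize; positivity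

/-- With `x = log (1 / ε)` one has `L * S = x / 2`, so `exp (L * S) = ε ^ (-1/2)` while the drift
carries a factor `ε`. The expression equals `(M / L) * (x / 2) ^ 2 * exp (-x / 2)`. -/
theorem tendsto_stepSize_mul_exp (hL : 0 < L) (M : ℝ) :
    Tendsto (fun ε => L * (M * stepSize L ε) * (stepSize L ε / ε)
      * Real.exp (L * (stepSize L ε / ε))) (𝓝[>] 0) (𝓝 0) := by
  have h := ((Real.tendsto_pow_mul_exp_neg_atTop_nhds_zero 2).comp
    (tendsto_log_one_div.const_mul_atTop (show (0 : ℝ) < 1 / 2 by norm_num))).const_mul (M / L)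
  rw [mul_zero] at h
  refine h.congr' ?_
  filter_upwards [self_mem_nhdsWithin] with ε hε
  have hε0 : 0 < ε := hε
  set x := Real.log (1 / ε) with hx
  have hεx : ε = Real.exp (-(1 / 2 * x)) * Real.exp (-(1 / 2 * x)) := by
    rw [← Real.exp_add, show -(1 / 2 * x) + -(1 / 2 * x) = -x by ring, hx, one_div, Real.log_inv,
      neg_neg, Real.exp_log hε0]
  have hS : stepSize L ε / ε = x / (2 * L) := by rw [stepSize]; field_simp; rfl
  have hD : stepSize L ε = ε * (x / (2 * L)) := by rw [← hS]; field_simp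
  have hLS : L * (x / (2 * L)) = 1 / 2 * x := by field_simp
  rw [hS, hD, hLS]
  have he : Real.exp (-(1 / 2 * x)) * Real.exp (1 / 2 * x) = 1 := by rw [← Real.exp_add]; simp
  simp only [Function.comp]
  rw [← hx]
  generalize Real.exp (-(1 / 2 * x)) = a at *
  generalize Real.exp (1 / 2 * x) = b at *
  rw [hεx]
  field_simp
  linear_combination (-M * x ^ 2 * a) * he

theorem tendsto_stepSize (hL : 0 < L) : Tendsto (stepSize L) (𝓝[>] 0) (𝓝 0) := by
  have h := ((Real.tendsto_pow_mul_exp_neg_atTop_nhds_zero 1).comp tendsto_log_one_div).const_mul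
    (1 / (2 * L))
  rw [mul_zero] at h
  refine h.congr' ?_
  filter_upwards [self_mem_nhdsWithin] with ε hε
  have hε0 : 0 < ε := hε
  simp only [Function.comp, one_div, Real.log_inv, neg_neg, Real.exp_log hε0, stepSize]
  field_simp

end StepSize

theorem aestronglyMeasurable_comp_triple [CompactSpace U] [BorelSpace U] {u : ℝ → U}
    {y : ℝ → Euc m} {z : ℝ → Euc n} (hu : Measurable u) (hy : ContinuousOn y (Ici 0))
    (hz : ContinuousOn z (Ici 0)) {V : Type*} [TopologicalSpace V]
    [TopologicalSpace.PseudoMetrizableSpace V] [SecondCountableTopology V]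
    {p : U × Euc m × Euc n → V} (hp : Continuous p) :
    AEStronglyMeasurable (fun t => p (u t, y t, z t)) (volume.restrict (Ici 0)) := by
  borelize V
  have : AEMeasurable (fun t => (u t, y t, z t)) (volume.restrict (Ici 0)) :=
    hu.aemeasurable.prodMk ((hy.aemeasurable measurableSet_Ici).prodMk
      (hz.aemeasurable measurableSet_Ici))
  exact (hp.measurable.comp_aemeasurable this).aestronglyMeasurable

omit [MetricSpace U] in
theorem norm_avg_le {V : Type*} [NormedAddCommGroup V] [NormedSpace ℝ V]
    {p : U × Euc m × Euc n → V} {B : ℝ} (hB : ∀ u, ∀ y ∈ P.Y, ∀ z ∈ P.Z, ‖p (u, y, z)‖ ≤ B)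
    (ν : ProbabilityMeasure (U × P.Y)) (ζ : P.Z) : ‖P.avg p ν ζ‖ ≤ B := by
  have := norm_integral_le_of_norm_le_const (μ := (ν : Measure (U × P.Y)))
    (f := fun x => p (x.1, (x.2 : Euc m), (ζ : Euc n))) (C := B)
    (Eventually.of_forall fun x => hB _ _ x.2.2 _ ζ.2)
  simpa [avg] using this

/-! ### Averaging of scalar functions along the constructed trajectory. -/

section Averaging

variable [CompactSpace U] [BorelSpace U]
  {q : ℕ → U × P.Y → ℝ} {μ : P.Z → ProbabilityMeasure (U × P.Y)}
  {us : P.Y → P.Z → ℝ → U} {ys : P.Y → P.Z → ℝ → P.Y} {L : ℝ}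
  {uε : ℝ → ℝ → U} {yε : ℝ → ℝ → P.Y} {zε : ℝ → ℝ → P.Z}

/-- On each step the constructed trajectory averages continuous functions to their mean against
the measure attained at the beginning of the step. -/
theorem eventually_abs_integral_step_sub_le (hP : P.Standing) (hq : IsTestSequence q)
    (hs : P.IsUniformSteering q μ us ys) (hL : P.IsLipConstF L)
    (hc : ∀ᶠ ε in 𝓝[>] (0 : ℝ), P.IsConstructed L us ε (uε ε) (yε ε) (zε ε))
    {p : U × Euc m × Euc n → ℝ} (hp : Continuous p) {η : ℝ} (hη : 0 < η) :
    ∀ᶠ ε in 𝓝[>] (0 : ℝ), ∀ l : ℕ,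
      |(∫ t in (l * stepSize L ε)..((l + 1) * stepSize L ε), p (uε ε t, yε ε t, zε ε t))
        - stepSize L ε * P.avg p (μ (zε ε (l * stepSize L ε))) (zε ε (l * stepSize L ε))|
      ≤ η * stepSize L ε := by
  obtain ⟨M, hM⟩ := hP.exists_norm_le hP.g_cont
  obtain ⟨B, hB⟩ := hP.exists_norm_le hp
  -- Half of `η` pays for replacing the true state by the steered fast state and the frozen slow
  -- state, both within `δ` for small `ε`; the other half pays for the time average along the
  -- steering control.
  obtain ⟨δ, hδ, huc⟩ := Metric.uniformContinuousOn_iff.1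
    (hP.isCompact_prod.uniformContinuousOn_of_continuous hp.continuousOn) (η / 2) (by positivity)
  have hMD : ∀ᶠ ε in 𝓝[>] (0 : ℝ), M * stepSize L ε < δ :=
    ((tendsto_stepSize hL.1).const_mul (M : ℝ)).eventually_lt_const (by rwa [mul_zero])
  filter_upwards [self_mem_nhdsWithin, hc, eventually_stepSize_pos hL.1, hMD,
    (tendsto_stepSize_mul_exp hL.1 M).eventually_lt_const hδ,
    (tendsto_stepSize_div hL.1).eventually
      (hs.eventually_abs_average_sub_le hP hq hp (half_pos hη))] with ε hε hc hD hMD hR hav l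
  replace hε : 0 < ε := hε
  have hfast := hc.norm_fast_sub_le hs hL hM hε hD l
  set D := stepSize L ε with hDdef
  set S := D / ε with hS
  set y0 := yε ε (l * D) with hy0
  set ζ := zε ε (l * D) with hζ
  have hεS : ε * S = D := by rw [hS]; field_simp
  have hS0 : 0 < S := by positivity
  have hl0 : 0 ≤ l * D := by positivity
  obtain ⟨⟨hum, -, -, hyv, hzv⟩, hus⟩ := hc
  obtain ⟨⟨husm, hysv⟩, -⟩ := hs.1 y0 ζ
  have hmaps : MapsTo (fun τ => l * D + ε * τ) (Ici 0) (Ici 0) := fun τ hτ =>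
    add_nonneg hl0 (mul_nonneg hε.le hτ)
  have haff : Continuous fun τ : ℝ => l * D + ε * τ := by fun_prop
  have hm1 : AEStronglyMeasurable (fun τ => p (uε ε (l * D + ε * τ),
      (yε ε (l * D + ε * τ) : Euc m), (zε ε (l * D + ε * τ) : Euc n))) (volume.restrict (Ici 0)) :=
    aestronglyMeasurable_comp_triple (hum.comp haff.measurable)
      (hyv.continuousOn.comp haff.continuousOn hmaps)
      (hzv.continuousOn.comp haff.continuousOn hmaps) hp
  have hm2 : AEStronglyMeasurable (fun τ => p (us y0 ζ τ, (ys y0 ζ τ : Euc m), (ζ : Euc n)))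
      (volume.restrict (Ici 0)) :=
    aestronglyMeasurable_comp_triple husm hysv.continuousOn continuousOn_const hp
  have hi1 := intervalIntegrable_of_norm_le hm1 (fun t _ => hB _ _ (yε ε _).2 _ (zε ε _).2)
    le_rfl hS0.le
  have hi2 := intervalIntegrable_of_norm_le hm2 (fun t _ => hB _ _ (ys _ _ _).2 _ ζ.2)
    le_rfl hS0.le
  have hchange : (∫ t in (l * D)..((l + 1) * D), p (uε ε t, yε ε t, zε ε t))
      = ε * ∫ τ in (0 : ℝ)..S, p (uε ε (l * D + ε * τ), yε ε (l * D + ε * τ),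
        zε ε (l * D + ε * τ)) := by
    have := intervalIntegral.smul_integral_comp_add_mul (a := 0) (b := S)
      (fun t => p (uε ε t, (yε ε t : Euc m), (zε ε t : Euc n))) ε (l * D)
    rw [mul_zero, add_zero, hεS, show l * D + D = (l + 1) * D by ring] at this
    rw [← this, smul_eq_mul]
  have hdiff : |(∫ τ in (0 : ℝ)..S, p (uε ε (l * D + ε * τ), yε ε (l * D + ε * τ),
        zε ε (l * D + ε * τ))) - ∫ τ in (0 : ℝ)..S, p (us y0 ζ τ, ys y0 ζ τ, ζ)|
      ≤ η / 2 * S := by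
    rw [← intervalIntegral.integral_sub hi1 hi2]
    have := intervalIntegral.norm_integral_le_of_norm_le_const_ae (a := 0) (b := S) (C := η / 2)
      (f := fun τ => p (uε ε (l * D + ε * τ), (yε ε (l * D + ε * τ) : Euc m),
        (zε ε (l * D + ε * τ) : Euc n)) - p (us y0 ζ τ, (ys y0 ζ τ : Euc m), (ζ : Euc n))) ?_
    · rwa [sub_zero, abs_of_pos hS0] at this
    filter_upwards [compl_mem_ae_iff.2 (measure_singleton S)] with σ hσS hσ
    rw [uIoc_of_le hS0.le] at hσ
    have hσ' : σ < S := lt_of_le_of_ne hσ.2 hσS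
    have hlt : ε * σ < D := by rw [← hεS]; gcongr
    have hεσ : 0 ≤ ε * σ := mul_nonneg hε.le hσ.1.le
    have hu : uε ε (l * D + ε * σ) = us y0 ζ σ := by
      rw [hus l (l * D + ε * σ) ⟨by linarith, by linarith⟩, add_sub_cancel_left,
        mul_div_cancel_left₀ _ hε.ne']
    rw [hu, ← dist_eq_norm]
    refine (huc _ ⟨mem_univ _, (yε ε _).2, (zε ε _).2⟩ _ ⟨mem_univ _, (ys _ _ _).2, ζ.2⟩ ?_).le
    rw [Prod.dist_eq, Prod.dist_eq, dist_self]
    refine max_lt hδ (max_lt ?_ ?_)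
    · rw [dist_eq_norm]
      exact (hfast σ ⟨hσ.1.le, hσ.2⟩).trans_lt hR
    · rw [dist_eq_norm]
      refine (hzv.norm_sub_le (M := M) (fun t _ => hM _ _ (yε ε t).2 _ (zε ε t).2) hl0
        (by positivity)).trans_lt (lt_of_le_of_lt ?_ hMD)
      rw [add_sub_cancel_left, abs_of_nonneg hεσ]
      gcongr
  have h2 := hav y0 ζ
  rw [hchange]
  have h3 : |(∫ τ in (0 : ℝ)..S, p (us y0 ζ τ, ys y0 ζ τ, ζ)) - S * P.avg p (μ ζ) ζ|
      ≤ η / 2 * S := by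
    have := mul_le_mul_of_nonneg_left h2 hS0.le
    rw [← abs_of_pos hS0, ← abs_mul, abs_of_pos hS0, mul_sub, ← mul_assoc,
      mul_inv_cancel₀ hS0.ne', one_mul] at this
    linarith
  have h4 := abs_sub_le (∫ τ in (0 : ℝ)..S, p (uε ε (l * D + ε * τ), yε ε (l * D + ε * τ),
        zε ε (l * D + ε * τ))) (∫ τ in (0 : ℝ)..S, p (us y0 ζ τ, ys y0 ζ τ, ζ))
        (S * P.avg p (μ ζ) ζ)
  have h5 := mul_le_mul_of_nonneg_left (h4.trans (add_le_add hdiff h3)) hε.le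
  rw [← abs_of_pos hε, ← abs_mul, abs_of_pos hε, mul_sub, ← mul_assoc ε S, hεS] at h5
  refine h5.trans_eq ?_
  rw [← hεS]; ring

/-- The constructed trajectory averages continuous functions to their mean against the measure
attained at the last sampling time. -/
theorem eventually_abs_integral_sub_sampled_le (hP : P.Standing) (hq : IsTestSequence q)
    (hs : P.IsUniformSteering q μ us ys) (hL : P.IsLipConstF L)
    (hc : ∀ᶠ ε in 𝓝[>] (0 : ℝ), P.IsConstructed L us ε (uε ε) (yε ε) (zε ε))
    {p : U × Euc m × Euc n → ℝ} (hp : Continuous p) {η : ℝ} (hη : 0 < η) :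
    ∀ᶠ ε in 𝓝[>] (0 : ℝ), ∀ t : ℝ, 0 ≤ t →
      |∫ s in (0 : ℝ)..t, (p (uε ε s, yε ε s, zε ε s)
        - P.avg p (μ (zε ε (sampleTime (stepSize L ε) s))) (zε ε (sampleTime (stepSize L ε) s)))|
      ≤ η * (t + 1) := by
  obtain ⟨B, hB⟩ := hP.exists_norm_le hp
  have hBD : ∀ᶠ ε in 𝓝[>] (0 : ℝ), 2 * B * stepSize L ε < η :=
    ((tendsto_stepSize hL.1).const_mul (2 * B : ℝ)).eventually_lt_const (by rwa [mul_zero])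
  filter_upwards [hc, eventually_stepSize_pos hL.1, hBD,
    eventually_abs_integral_step_sub_le hP hq hs hL hc hp hη] with ε hc hD hBD hstep t ht
  obtain ⟨⟨hum, -, -, hyv, hzv⟩, -⟩ := hc
  set D := stepSize L ε
  have hm1 := aestronglyMeasurable_comp_triple hum hyv.continuousOn hzv.continuousOn hp
  have hm2 := (stronglyMeasurable_comp_sampleTime (fun s => P.avg p (μ (zε ε s)) (zε ε s))
    D).aestronglyMeasurable (μ := volume.restrict (Ici 0))
  have hb1 : ∀ s, ‖p (uε ε s, (yε ε s : Euc m), (zε ε s : Euc n))‖ ≤ B := fun s =>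
    hB _ _ (yε ε s).2 _ (zε ε s).2
  have hb2 : ∀ s, ‖P.avg p (μ (zε ε (sampleTime D s))) (zε ε (sampleTime D s))‖ ≤ B := fun s =>
    norm_avg_le hB _ _
  -- The incomplete last step costs at most `2 * B * D < η`, whence the bound `η * (t + 1)`.
  refine (abs_integral_le_of_steps hη.le hD (hm1.sub hm2) (B := 2 * B) (fun s _ => ?_)
    (fun l => ?_) ht).trans (by linarith)
  · have := (norm_sub_le _ _).trans (add_le_add (hb1 s) (hb2 s))
    rw [← two_mul] at this
    exact this
  · have hl0 : 0 ≤ l * D := by positivity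
    have hl1 : 0 ≤ (l + 1) * D := by positivity
    have hle : l * D ≤ (l + 1) * D := by linarith
    have h1 := intervalIntegrable_of_norm_le hm1 (fun s _ => hb1 s) hl0 hl1
    have h2 := intervalIntegrable_of_norm_le hm2 (fun s _ => hb2 s) hl0 hl1
    have h3 : ∫ s in (l * D)..((l + 1) * D), P.avg p (μ (zε ε (sampleTime D s)))
        (zε ε (sampleTime D s)) = D * P.avg p (μ (zε ε (l * D))) (zε ε (l * D)) := by
      rw [intervalIntegral.integral_congr_ae (g := fun _ => P.avg p (μ (zε ε (l * D)))
        (zε ε (l * D)))]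
      · rw [intervalIntegral.integral_const, smul_eq_mul]; ring
      · filter_upwards [compl_mem_ae_iff.2 (measure_singleton ((l + 1) * D))] with s hs1 hs2
        rw [uIoc_of_le hle] at hs2
        rw [sampleTime_eq hD ⟨hs2.1.le, lt_of_le_of_ne hs2.2 hs1⟩]
    have h4 := hstep l
    rw [← h3, ← intervalIntegral.integral_sub h1 h2] at h4
    exact h4

end Averaging

end SPProblem

/-! ### Convergence of the slow trajectories. -/

namespace SPProblem

variable {U : Type*} {m n : ℕ} [MetricSpace U] [MeasurableSpace U] {P : SPProblem U m n}

section Averaging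

variable [CompactSpace U] [BorelSpace U]
  {q : ℕ → U × P.Y → ℝ} {μ : P.Z → ProbabilityMeasure (U × P.Y)} {z : ℝ → P.Z}
  {us : P.Y → P.Z → ℝ → U} {ys : P.Y → P.Z → ℝ → P.Y} {L : ℝ}
  {uε : ℝ → ℝ → U} {yε : ℝ → ℝ → P.Y} {zε : ℝ → ℝ → P.Z}

theorem Standing.integrable_avg (hP : P.Standing) {V : Type*} [NormedAddCommGroup V]
    {p : U × Euc m × Euc n → V} (hp : Continuous p) (ν : Measure (U × P.Y))
    [IsFiniteMeasure ν] (ζ : P.Z) :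
    Integrable (fun x : U × P.Y => p (x.1, (x.2 : Euc m), (ζ : Euc n))) ν := by
  have := hP.compactSpace_Y
  exact (by fun_prop : Continuous fun x : U × P.Y => p (x.1, (x.2 : Euc m), (ζ : Euc n)))
    |>.integrable_of_hasCompactSupport (HasCompactSupport.of_compactSpace _)

theorem Standing.avg_apply (hP : P.Standing) {k : ℕ} {p : U × Euc m × Euc n → Euc k}
    (hp : Continuous p) (ν : ProbabilityMeasure (U × P.Y)) (ζ : P.Z) (i : Fin k) :
    P.avg p ν ζ i = P.avg (fun x => p x i) ν ζ :=
  ((EuclideanSpace.proj (𝕜 := ℝ) i).integral_comp_comm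
    (hP.integrable_avg hp (ν : Measure (U × P.Y)) ζ)).symm

/-- Vector version of `eventually_abs_integral_sub_sampled_le`. -/
theorem eventually_norm_integral_sub_sampled_le (hP : P.Standing) (hq : IsTestSequence q)
    (hs : P.IsUniformSteering q μ us ys) (hL : P.IsLipConstF L)
    (hc : ∀ᶠ ε in 𝓝[>] (0 : ℝ), P.IsConstructed L us ε (uε ε) (yε ε) (zε ε))
    {k : ℕ} {p : U × Euc m × Euc n → Euc k} (hp : Continuous p) {η : ℝ} (hη : 0 < η) :
    ∀ᶠ ε in 𝓝[>] (0 : ℝ), ∀ t : ℝ, 0 ≤ t →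
      ‖∫ s in (0 : ℝ)..t, (p (uε ε s, yε ε s, zε ε s)
        - P.avg p (μ (zε ε (sampleTime (stepSize L ε) s))) (zε ε (sampleTime (stepSize L ε) s)))‖
      ≤ η * (t + 1) := by
  have hcoord : ∀ i : Fin k, Continuous fun x => p x i := fun i =>
    (EuclideanSpace.proj (𝕜 := ℝ) i).continuous.comp hp
  -- The estimate is summed over `k` coordinates; dividing by `k + 1` also covers dimension `0`.
  have hall := eventually_all.2 fun i : Fin k => eventually_abs_integral_sub_sampled_le hP hq hs hL
    hc (hcoord i) (η := η / (k + 1)) (by positivity)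
  obtain ⟨B, hB⟩ := hP.exists_norm_le hp
  filter_upwards [hc, hall] with ε hc hall t ht
  obtain ⟨⟨hum, -, -, hyv, hzv⟩, -⟩ := hc
  set D := stepSize L ε
  have h1 := intervalIntegrable_of_norm_le
    (aestronglyMeasurable_comp_triple hum hyv.continuousOn hzv.continuousOn hp)
    (fun s _ => hB _ _ (yε ε s).2 _ (zε ε s).2) le_rfl ht
  have h2 := intervalIntegrable_of_norm_le
    ((stronglyMeasurable_comp_sampleTime (fun s => P.avg p (μ (zε ε s)) (zε ε s))
      D).aestronglyMeasurable (μ := volume.restrict (Ici 0))) (fun s _ => norm_avg_le hB _ _)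
    le_rfl ht
  refine (EuclideanSpace.norm_le_sum_abs _).trans ?_
  calc _ ≤ ∑ _i : Fin k, η / (k + 1) * (t + 1) := Finset.sum_le_sum fun i _ => by
        have h3 := (EuclideanSpace.proj (𝕜 := ℝ) i).intervalIntegral_comp_comm (h1.sub h2)
        have h4 := hall i t ht
        simp only [← hP.avg_apply hp] at h4
        refine le_trans (le_of_eq ?_) h4
        congr 1
        exact h3.symm
    _ ≤ η * (t + 1) := by
        rw [Finset.sum_const, Finset.card_univ, Fintype.card_fin, nsmul_eq_mul, ← mul_assoc]
        gcongr
        rw [mul_div_assoc', div_le_iff₀ (by positivity)]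
        nlinarith

/-- The slow trajectories converge to the averaged one, uniformly on bounded intervals. -/
theorem eventually_norm_slow_sub_le (hP : P.Standing) (hq : IsTestSequence q)
    (hs : P.IsUniformSteering q μ us ys) (hL : P.IsLipConstF L)
    (hc : ∀ᶠ ε in 𝓝[>] (0 : ℝ), P.IsConstructed L us ε (uε ε) (yε ε) (zε ε))
    (hflow : P.IsAvgFlow μ z) (htube : P.StaysInTube μ z zε) {T η : ℝ} (hT : 0 < T) (hη : 0 < η) :
    ∀ᶠ ε in 𝓝[>] (0 : ℝ), ∀ t ∈ Icc 0 T, ‖(zε ε t : Euc n) - z t‖ ≤ η := by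
  obtain ⟨M, hM⟩ := hP.exists_norm_le hP.g_cont
  obtain ⟨s, a, ⟨-, -, ⟨K, hK⟩, har⟩, δ, hδ, hin⟩ := htube T hT
  set γ : P.Z → Euc n := fun ζ => P.avg P.g (μ ζ) ζ with hγ
  have hγM : ∀ ζ, ‖γ ζ‖ ≤ M := fun ζ => norm_avg_le hM _ _
  set F : ℝ → ℝ → Euc n := fun ε σ => γ (zε ε (sampleTime (stepSize L ε) σ)) - γ (z σ) with hF
  have hFM : ∀ ε σ, ‖F ε σ‖ ≤ 2 * M := fun ε σ => by
    rw [two_mul]; exact (norm_sub_le _ _).trans (add_le_add (hγM _) (hγM _))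
  set w : ℝ → ℝ → ℝ := fun ε σ => ‖(zε ε σ : Euc n) - z σ‖ with hw
  -- The excess of `F` over its expected Lipschitz bound. It is bounded, and at each fixed time
  -- outside `s` it vanishes for small `ε`, so its integral tends to `0` without a rate near the
  -- exceptional times.
  set e : ℝ → ℝ → ℝ := fun ε σ => max 0 (‖F ε σ‖ - K * (M * stepSize L ε + w ε σ)) with he
  have hzlip : ∀ {a b : ℝ}, 0 ≤ a → 0 ≤ b → ‖(z b : Euc n) - z a‖ ≤ M * |b - a| :=
    hflow.2.norm_sub_le fun t _ => hγM _
  have hzεc : ∀ ε, P.IsConstructed L us ε (uε ε) (yε ε) (zε ε) → ContinuousOn (w ε) (Ici 0) :=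
    fun ε hc => (hc.1.2.2.2.2.continuousOn.sub hflow.2.continuousOn).norm
  have hFm : ∀ ε, AEStronglyMeasurable (F ε) (volume.restrict (Ioc 0 T)) := fun ε =>
    (stronglyMeasurable_comp_sampleTime (fun s => γ (zε ε s)) _).aestronglyMeasurable.sub
      (hflow.2 T hT.le).1.1.aestronglyMeasurable
  have hem : ∀ ε, P.IsConstructed L us ε (uε ε) (yε ε) (zε ε) →
      AEStronglyMeasurable (e ε) (volume.restrict (Ioc 0 T)) := by
    intro ε hc
    have hwm : AEStronglyMeasurable (w ε) (volume.restrict (Ioc 0 T)) :=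
      ((hzεc ε hc).mono fun x hx => hx.1.le).aestronglyMeasurable measurableSet_Ioc
    exact aestronglyMeasurable_const.sup
      ((hFm ε).norm.sub ((aestronglyMeasurable_const.add hwm).const_mul (K : ℝ)))
  have heb : ∀ᶠ ε in 𝓝[>] (0 : ℝ), ∀ σ, ‖e ε σ‖ ≤ 2 * M := by
    filter_upwards [eventually_stepSize_pos hL.1] with ε hD σ
    rw [Real.norm_eq_abs, abs_of_nonneg (le_max_left _ _)]
    refine max_le (by positivity) ?_
    have h1 : 0 ≤ K * (M * stepSize L ε + w ε σ) := by positivity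
    linarith [hFM ε σ]
  have hzero : ∀ σ ∈ Icc 0 T, σ ∉ s → ∀ᶠ ε in 𝓝[>] (0 : ℝ), e ε σ = 0 := by
    intro σ hσ hσs
    -- The margin is `2 * d` so that the sampling time `θ`, which lags `σ` by less than `d`, still
    -- keeps distance more than `d` from `s`.
    obtain ⟨d, hd, hdist⟩ : ∃ d : ℝ, 0 < d ∧ ∀ x ∈ s, 2 * d ≤ |σ - x| := by
      have hcl : IsClosed (s : Set ℝ) := s.finite_toSet.isClosed
      obtain ⟨r, hr, hball⟩ := Metric.isOpen_iff.1 hcl.isOpen_compl σ hσs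
      refine ⟨r / 2, by positivity, fun x hx => ?_⟩
      by_contra hlt
      have : x ∈ Metric.ball σ r := by
        rw [Metric.mem_ball, dist_comm, Real.dist_eq]; linarith
      exact hball this hx
    obtain ⟨r, hr, hra⟩ := har d hd
    have h1 : ∀ᶠ ε in 𝓝[>] (0 : ℝ), M * stepSize L ε < r :=
      ((tendsto_stepSize hL.1).const_mul (M : ℝ)).eventually_lt_const (by rwa [mul_zero])
    filter_upwards [hc, eventually_stepSize_pos hL.1, h1,
      (tendsto_stepSize hL.1).eventually_lt_const hd, hδ.eventually_lt_const hd, hin]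
      with ε hc hD hMr hDd hδd hin
    set θ := sampleTime (stepSize L ε) σ with hθ
    have hθ0 : 0 ≤ θ := sampleTime_nonneg hD σ
    have hθT : θ ∈ Icc 0 T := ⟨hθ0, (sampleTime_le hD hσ.1).trans hσ.2⟩
    have hσθ : |σ - θ| ≤ stepSize L ε := abs_sub_sampleTime_le hD hσ.1
    have hfar : ∀ x ∈ s, d < |θ - x| := by
      intro x hx
      have h2 := hdist x hx
      have h3 := abs_sub_le σ θ x
      linarith
    have hθd : ∀ c : ℝ, c ≤ d → ∀ x ∈ s, θ ∉ Ioo (x - c) (x + c) := by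
      intro c hcd x hx hmem
      have h2 := hfar x hx
      have h3 : |θ - x| < c := abs_lt.2 ⟨by linarith [hmem.1], by linarith [hmem.2]⟩
      linarith
    have hθs : θ ∉ s := fun h => by
      have := hfar θ h
      rw [sub_self, abs_zero] at this
      linarith
    have hrθ := hra θ hθT (hθd d le_rfl)
    -- The ball is centred at `z θ`, not `z σ`: it contains `zε ε θ` by the tube hypothesis, and `z
    -- σ` because `z` moves by less than the lower bound `r` of the radii during one step.
    have hmem1 := hin.2 θ hθT (hθd _ hδd.le)
    have hmem2 : z σ ∈ Metric.ball (z θ) (a θ) := by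
      rw [Metric.mem_ball, Subtype.dist_eq, dist_eq_norm]
      have := hzlip hθ0 hσ.1
      have h4 : (M : ℝ) * |σ - θ| ≤ M * stepSize L ε := by gcongr
      linarith
    have hlip := (hK θ hθT hθs).dist_le_mul _ hmem1 _ hmem2
    rw [dist_eq_norm, Subtype.dist_eq, dist_eq_norm] at hlip
    have h5 := hc.1.2.2.2.2.norm_sub_le (M := M) (fun t _ => hM _ _ (yε ε t).2 _ (zε ε t).2)
      hσ.1 hθ0
    rw [abs_sub_comm] at h5
    have h6 : (M : ℝ) * |σ - θ| ≤ M * stepSize L ε := by gcongr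
    have h7 := norm_sub_le_norm_sub_add_norm_sub (zε ε θ : Euc n) (zε ε σ) (z σ)
    have h8 : (K : ℝ) * ‖(zε ε θ : Euc n) - z σ‖ ≤ K * (M * stepSize L ε + w ε σ) := by
      gcongr
      exact h7.trans (add_le_add (h5.trans h6) le_rfl)
    exact max_eq_left (by linarith [hlip])
  have hlim : Tendsto (fun ε => ∫ σ in (0 : ℝ)..T, e ε σ) (𝓝[>] 0) (𝓝 0) := by
    have := intervalIntegral.tendsto_integral_filter_of_dominated_convergence
      (μ := volume) (a := 0) (b := T) (F := e) (l := 𝓝[>] (0 : ℝ)) (f := fun _ => (0 : ℝ))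
      (fun _ => 2 * (M : ℝ)) ?_ ?_ intervalIntegrable_const ?_
    · simpa using this
    · filter_upwards [hc] with ε hc
      rw [uIoc_of_le hT.le]; exact hem ε hc
    · filter_upwards [heb] with ε hε
      exact Eventually.of_forall fun σ _ => hε σ
    · filter_upwards [compl_mem_ae_iff.2 (s.finite_toSet.measure_zero volume)] with σ hσs hσ
      rw [uIoc_of_le hT.le] at hσ
      exact tendsto_const_nhds.congr' ((hzero σ ⟨hσ.1.le, hσ.2⟩ hσs).mono fun ε h => h.symm)
  -- Three errors of size `κ` enter Grönwall: averaging of `g`, the integral of `e`, and the lag of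
  -- the sampling times. The exponential weight makes the final bound equal to `η`.
  set κ : ℝ := η * Real.exp (-(K * T)) / 3 with hκ
  have hκ0 : 0 < κ := by positivity
  have hκE : 3 * κ * Real.exp (K * T) = η := by
    rw [hκ, mul_div_cancel₀ _ (by norm_num : (3 : ℝ) ≠ 0), mul_assoc, ← Real.exp_add]; simp
  have hKM : ∀ᶠ ε in 𝓝[>] (0 : ℝ), K * M * T * stepSize L ε < κ :=
    ((tendsto_stepSize hL.1).const_mul (K * M * T : ℝ)).eventually_lt_const (by rwa [mul_zero])
  filter_upwards [hc, eventually_stepSize_pos hL.1, hKM, hlim.eventually_lt_const hκ0, heb,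
    eventually_norm_integral_sub_sampled_le hP hq hs hL hc hP.g_cont
      (η := κ / (T + 1)) (by positivity)] with ε hc hD hKM hlim heb hav
  have hwc := hzεc ε hc
  have hei : ∀ t ∈ Icc 0 T, IntervalIntegrable (e ε) volume 0 t := by
    intro t ht
    refine (intervalIntegrable_const (c := 2 * (M : ℝ))).mono_fun ?_ ?_
    · rw [uIoc_of_le ht.1]
      exact (hem ε hc).mono_measure (Measure.restrict_mono (Ioc_subset_Ioc_right ht.2) le_rfl)
    · exact Eventually.of_forall fun σ => (heb σ).trans (le_abs_self _)
  have hgr := le_mul_exp_of_le_add_integral (v := w ε) (E := 3 * κ) K.coe_nonneg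
    (hwc.mono Icc_subset_Ici_self) (T := T) ?_
  · intro t ht
    refine (hgr t ht).trans ?_
    rw [← hκE]
    have := ht.2
    gcongr
  intro t ht
  obtain ⟨⟨hum, -, hz0, hyv, hzv⟩, -⟩ := hc
  have hi1 : IntervalIntegrable (fun s => P.g (uε ε s, (yε ε s : Euc m), (zε ε s : Euc n)))
    volume 0 t := (hzv t ht.1).1
  have hi2 : IntervalIntegrable (fun s => γ (zε ε (sampleTime (stepSize L ε) s))) volume 0 t :=
    intervalIntegrable_of_norm_le
      ((stronglyMeasurable_comp_sampleTime (fun s => γ (zε ε s))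
      (stepSize L ε)).aestronglyMeasurable (μ := volume.restrict (Ici 0))) (fun s _ => hγM _)
      le_rfl ht.1
  have hi3 : IntervalIntegrable (fun s => γ (z s)) volume 0 t := (hflow.2 t ht.1).1
  have hdecomp : (zε ε t : Euc n) - z t
      = (∫ s in (0 : ℝ)..t, (P.g (uε ε s, (yε ε s : Euc m), (zε ε s : Euc n))
          - γ (zε ε (sampleTime (stepSize L ε) s)))) + ∫ s in (0 : ℝ)..t, F ε s := by
    have e1 := (hzv t ht.1).2
    have e2 := (hflow.2 t ht.1).2
    simp only at e1 e2 hz0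
    rw [hz0] at e1
    rw [hflow.1] at e2
    rw [← intervalIntegral.integral_add (hi1.sub hi2) (hi2.sub hi3), e1, e2,
      add_sub_add_left_eq_sub, ← intervalIntegral.integral_sub hi1 hi3]
    exact intervalIntegral.integral_congr fun s _ => (sub_add_sub_cancel _ _ _).symm
  have hwi : IntervalIntegrable (w ε) volume 0 t := by
    refine ContinuousOn.intervalIntegrable (hwc.mono ?_)
    rw [uIcc_of_le ht.1]; exact Icc_subset_Ici_self
  have hF2 : ‖∫ s in (0 : ℝ)..t, F ε s‖
      ≤ ∫ s in (0 : ℝ)..t, (e ε s + (K * w ε s + K * (M * stepSize L ε))) := by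
    refine intervalIntegral.norm_integral_le_of_norm_le ht.1 (Eventually.of_forall fun σ _ => ?_)
      ((hei t ht).add ((hwi.const_mul _).add intervalIntegrable_const))
    have := le_max_right 0 (‖F ε σ‖ - K * (M * stepSize L ε + w ε σ))
    have h2 : e ε σ = max 0 (‖F ε σ‖ - K * (M * stepSize L ε + w ε σ)) := rfl
    rw [h2]
    linarith
  rw [intervalIntegral.integral_add (hei t ht) ((hwi.const_mul _).add intervalIntegrable_const),
    intervalIntegral.integral_add (hwi.const_mul _) intervalIntegrable_const,
    intervalIntegral.integral_const_mul, intervalIntegral.integral_const, sub_zero,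
    smul_eq_mul] at hF2
  have hmono : ∫ s in (0 : ℝ)..t, e ε s ≤ ∫ s in (0 : ℝ)..T, e ε s :=
    intervalIntegral.integral_mono_interval le_rfl ht.1 ht.2
      (Eventually.of_forall fun σ => le_max_left _ _) (hei T ⟨hT.le, le_rfl⟩)
  have h1 := hav t ht.1
  have h2 : κ / (T + 1) * (t + 1) ≤ κ := by
    rw [div_mul_eq_mul_div, div_le_iff₀ (by positivity)]
    have := ht.2
    gcongr
  have h3 : t * (K * (M * stepSize L ε)) ≤ K * M * T * stepSize L ε := by
    calc _ ≤ T * (K * (M * stepSize L ε)) := by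
          have := ht.2
          gcongr
      _ = _ := by ring
  have h4 : w ε t ≤ _ := (congrArg norm hdecomp).le.trans (norm_add_le _ _)
  linarith

end Averaging

end SPProblem

/-! ### Convergence of the discounted costs. -/

namespace SPProblem

variable {U : Type*} {m n : ℕ} [MetricSpace U] [MeasurableSpace U] {P : SPProblem U m n}

section Averaging

variable [CompactSpace U] [BorelSpace U]
  {q : ℕ → U × P.Y → ℝ} {μ : P.Z → ProbabilityMeasure (U × P.Y)} {z : ℝ → P.Z}
  {us : P.Y → P.Z → ℝ → U} {ys : P.Y → P.Z → ℝ → P.Y} {L : ℝ}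
  {uε : ℝ → ℝ → U} {yε : ℝ → ℝ → P.Y} {zε : ℝ → ℝ → P.Z}

/-- The averages of a continuous function are continuous at almost all points of the averaged
trajectory. -/
theorem IsWeaklyPiecewiseLipschitz.ae_continuousAt (hP : P.Standing)
    (hlip : P.IsWeaklyPiecewiseLipschitz μ z) {p : U × Euc m × Euc n → ℝ} (hp : Continuous p) :
    ∀ᵐ t, 0 < t → ContinuousAt (fun ζ => P.avg p (μ ζ) ζ) (z t) := by
  have happ : ∀ k : ℕ, ∃ (K : ℝ≥0) (r : U × Euc m × Euc n → ℝ), LipschitzWith K r ∧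
      ∀ x ∈ (univ : Set U) ×ˢ P.Y ×ˢ P.Z, |r x - p x| ≤ 1 / (k + 1) := fun k =>
    hP.isCompact_prod.exists_lipschitzWith_abs_sub_le hp (by positivity)
  choose K r hr hrp using happ
  have h1 : ∀ k N : ℕ, ∀ᵐ t, t ∈ Ioc (0 : ℝ) (N + 1) →
      ContinuousAt (fun ζ => P.avg (r k) (μ ζ) ζ) (z t) := by
    intro k N
    obtain ⟨s, a, -, hapos, ⟨c, hc⟩, -⟩ := hlip.1 (r k) ⟨K k, hr k⟩ (N + 1) (by positivity)
    filter_upwards [compl_mem_ae_iff.2 (s.finite_toSet.measure_zero volume)] with t hts ht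
    have ht' : t ∈ Icc (0 : ℝ) (N + 1) := ⟨ht.1.le, ht.2⟩
    exact (hc t ht' hts).continuousOn.continuousAt (Metric.ball_mem_nhds _ (hapos t ht' hts))
  filter_upwards [ae_all_iff.2 fun k => ae_all_iff.2 (h1 k)] with t ht h0
  -- Piecewise Lipschitz continuity is assumed only for Lipschitz integrands. Uniform approximation
  -- of `p` on `U × Y × Z` makes the averages converge uniformly in `ζ`, which preserves continuity
  -- at `z t`.
  have hunif : TendstoUniformly (fun k ζ => P.avg (r k) (μ ζ) ζ) (fun ζ => P.avg p (μ ζ) ζ)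
      atTop := by
    rw [Metric.tendstoUniformly_iff]
    intro η hη
    filter_upwards [tendsto_one_div_add_atTop_nhds_zero_nat.eventually_lt_const hη] with k hk ζ
    refine lt_of_le_of_lt ?_ hk
    rw [dist_comm, dist_eq_norm, avg, avg, ← integral_sub
      (hP.integrable_avg (hr k).continuous (μ ζ : Measure (U × P.Y)) ζ)
      (hP.integrable_avg hp (μ ζ : Measure (U × P.Y)) ζ)]
    have := norm_integral_le_of_norm_le_const (μ := (μ ζ : Measure (U × P.Y)))
      (f := fun x => r k (x.1, (x.2 : Euc m), (ζ : Euc n)) - p (x.1, (x.2 : Euc m), (ζ : Euc n)))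
      (C := 1 / (k + 1))
      (Eventually.of_forall fun x => hrp k _ ⟨mem_univ _, x.2.2, ζ.2⟩)
    simpa using this
  obtain ⟨N, hN⟩ := exists_nat_ge t
  refine continuousAt_of_locally_uniform_approx_of_continuousAt fun V hV => ?_
  obtain ⟨k, hk⟩ := (hunif V hV).exists
  exact ⟨univ, univ_mem, _, ht k N ⟨h0, by linarith⟩, fun ζ _ => hk ζ⟩

/-- The discounted costs of the constructed controls converge to that of the averaged
trajectory. -/
theorem tendsto_cost_constructed (hP : P.Standing) (hq : IsTestSequence q)
    (hs : P.IsUniformSteering q μ us ys) (hL : P.IsLipConstF L)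
    (hc : ∀ᶠ ε in 𝓝[>] (0 : ℝ), P.IsConstructed L us ε (uε ε) (yε ε) (zε ε))
    (hflow : P.IsAvgFlow μ z) (htube : P.StaysInTube μ z zε)
    (hlip : P.IsWeaklyPiecewiseLipschitz μ z) :
    Tendsto (fun ε => P.cost (uε ε) (fun t => (yε ε t : Euc m)) (fun t => (zε ε t : Euc n)))
      (𝓝[>] 0) (𝓝 (P.avgCost (fun t => μ (z t)) z)) := by
  obtain ⟨B, hB⟩ := hP.exists_norm_le hP.G_cont
  obtain ⟨M, hM⟩ := hP.exists_norm_le hP.g_cont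
  have hC := hP.C_pos
  set Γ : P.Z → ℝ := fun ζ => P.avg P.G (μ ζ) ζ with hΓ
  have hΓB : ∀ ζ, ‖Γ ζ‖ ≤ B := fun ζ => norm_avg_le hB _ _
  set θ : ℝ → ℝ → ℝ := fun ε t => sampleTime (stepSize L ε) t with hθ
  have hΓm : ∀ ε, StronglyMeasurable fun t => Γ (zε ε (θ ε t)) := fun ε =>
    stronglyMeasurable_comp_sampleTime (fun s => Γ (zε ε s)) _
  -- The cost sampled at the times `t_l` converges by dominated convergence: the sampled slow state
  -- tends to `z t`, where `Γ` is continuous for almost every `t`.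
  have hmain : Tendsto (fun ε => ∫ t in Ioi (0 : ℝ), Real.exp (-(P.C * t)) * Γ (zε ε (θ ε t)))
      (𝓝[>] 0) (𝓝 (P.avgCost (fun t => μ (z t)) z)) := by
    refine tendsto_integral_filter_of_dominated_convergence
      (fun t => Real.exp (-(P.C * t)) * B) ?_ ?_ ((integrableOn_exp_neg_mul hC).mul_const _) ?_
    · exact Eventually.of_forall fun ε =>
        (by fun_prop : Continuous fun t : ℝ => Real.exp (-(P.C * t))).aestronglyMeasurable.mul
          (hΓm ε).aestronglyMeasurable
    · refine Eventually.of_forall fun ε => Eventually.of_forall fun t => ?_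
      rw [norm_mul, Real.norm_of_nonneg (Real.exp_pos _).le]
      gcongr
      exact hΓB _
    · rw [ae_restrict_iff' measurableSet_Ioi]
      filter_upwards [hlip.ae_continuousAt hP hP.G_cont] with t hcont ht
      have ht0 : (0 : ℝ) < t := ht
      refine Tendsto.const_mul _ ((hcont ht0).tendsto.comp ?_)
      rw [tendsto_iff_dist_tendsto_zero]
      have hD := (tendsto_stepSize hL.1).const_mul (M : ℝ)
      rw [mul_zero] at hD
      rw [Metric.tendsto_nhds]
      intro η hη
      filter_upwards [hc, eventually_stepSize_pos hL.1, hD.eventually_lt_const (half_pos hη),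
        eventually_norm_slow_sub_le hP hq hs hL hc hflow htube ht0 (half_pos hη)]
        with ε hc hD0 hD hw
      rw [Real.dist_eq, sub_zero, abs_of_nonneg dist_nonneg, Subtype.dist_eq, dist_eq_norm]
      have h1 := hw t ⟨ht0.le, le_rfl⟩
      have h2 := hc.1.2.2.2.2.norm_sub_le (M := M) (fun t _ => hM _ _ (yε ε t).2 _ (zε ε t).2)
        ht0.le (sampleTime_nonneg hD0 t)
      rw [abs_sub_comm] at h2
      have h3 : (M : ℝ) * |t - sampleTime (stepSize L ε) t| ≤ M * stepSize L ε := by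
        gcongr
        exact abs_sub_sampleTime_le hD0 ht0.le
      have h4 := norm_sub_le_norm_sub_add_norm_sub (zε ε (θ ε t) : Euc n) (zε ε t) (z t)
      linarith
  set A : ℝ := P.C * ∫ t in Ioi (0 : ℝ), (t * Real.exp (-(P.C * t)) + Real.exp (-(P.C * t)))
    with hA
  have hAi := (integrableOn_mul_exp_neg_mul hC).add (integrableOn_exp_neg_mul hC)
  have hA0 : 0 ≤ A := by
    refine mul_nonneg hC.le (setIntegral_nonneg measurableSet_Ioi fun t ht => ?_)
    have : (0 : ℝ) < t := ht
    positivity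
  have hdiff : Tendsto (fun ε => P.cost (uε ε) (fun t => (yε ε t : Euc m))
      (fun t => (zε ε t : Euc n)) - ∫ t in Ioi (0 : ℝ), Real.exp (-(P.C * t)) * Γ (zε ε (θ ε t)))
      (𝓝[>] 0) (𝓝 0) := by
    rw [Metric.tendsto_nhds]
    intro η hη
    filter_upwards [hc, eventually_abs_integral_sub_sampled_le hP hq hs hL hc hP.G_cont
      (η := η / (A + 1)) (by positivity)] with ε hc hav
    obtain ⟨⟨hum, -, -, hyv, hzv⟩, -⟩ := hc
    set H : ℝ → ℝ := fun t => P.G (uε ε t, (yε ε t : Euc m), (zε ε t : Euc n)) - Γ (zε ε (θ ε t))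
      with hH
    have hGm := aestronglyMeasurable_comp_triple hum hyv.continuousOn hzv.continuousOn hP.G_cont
    have hGb : ∀ t, |P.G (uε ε t, (yε ε t : Euc m), (zε ε t : Euc n))| ≤ B := fun t =>
      hB _ _ (yε ε t).2 _ (zε ε t).2
    have hHm : AEStronglyMeasurable H (volume.restrict (Ici 0)) :=
      hGm.sub (hΓm ε).aestronglyMeasurable
    have hHb : ∀ t, |H t| ≤ 2 * B := fun t => by
      rw [two_mul]; exact (abs_sub _ _).trans (add_le_add (hGb t) (hΓB _))
    have hres : volume.restrict (Ioi (0 : ℝ)) ≤ volume.restrict (Ici 0) :=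
      Measure.restrict_mono Ioi_subset_Ici_self le_rfl
    have hHi : ∀ {a b : ℝ}, 0 ≤ a → 0 ≤ b → IntervalIntegrable H volume a b :=
      intervalIntegrable_of_norm_le hHm fun t _ => hHb t
    have hΨlip : LipschitzOnWith (2 * B) (fun t => ∫ s in (0 : ℝ)..t, H s) (Ici 0) := by
      refine LipschitzOnWith.of_dist_le_mul fun a ha b hb => ?_
      rw [dist_eq_norm, Real.dist_eq, intervalIntegral.integral_interval_sub_left
        (hHi le_rfl ha) (hHi le_rfl hb)]
      exact intervalIntegral.norm_integral_le_of_norm_le_const fun t _ => hHb t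
    -- `H` is small only after integration in time, so the discounted integral of `H` is rewritten
    -- as `C` times that of its primitive, which is at most `η / (A + 1) * (t + 1)`. The constant
    -- `A` is `C` times the discounted integral of `t + 1`.
    have hlap := integral_exp_neg_mul_deriv hC hΨlip
      (ae_hasDerivAt_integral_of_pos fun t ht => hHi le_rfl ht)
      (integrableOn_exp_neg_mul_of_bounded hC (hHm.mono_measure hres) fun t _ => hHb t)
    simp only [intervalIntegral.integral_same, neg_zero, zero_add] at hlap
    have hsub : P.cost (uε ε) (fun t => (yε ε t : Euc m)) (fun t => (zε ε t : Euc n))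
        - ∫ t in Ioi (0 : ℝ), Real.exp (-(P.C * t)) * Γ (zε ε (θ ε t))
        = ∫ t in Ioi (0 : ℝ), Real.exp (-(P.C * t)) * H t := by
      rw [cost, ← integral_sub (integrableOn_exp_neg_mul_of_bounded hC (hGm.mono_measure hres)
        fun t _ => hGb t) (integrableOn_exp_neg_mul_of_bounded hC
        (hΓm ε).aestronglyMeasurable fun t _ => hΓB _)]
      exact integral_congr_ae (Eventually.of_forall fun t => by simp only [hH]; ring)
    have hbd : |∫ t in Ioi (0 : ℝ), Real.exp (-(P.C * t)) * ∫ s in (0 : ℝ)..t, H s|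
        ≤ ∫ t in Ioi (0 : ℝ), η / (A + 1) * (t * Real.exp (-(P.C * t)) + Real.exp (-(P.C * t))) := by
      rw [← Real.norm_eq_abs]
      refine norm_integral_le_of_norm_le (hAi.const_mul (η / (A + 1))) ?_
      filter_upwards [ae_restrict_mem measurableSet_Ioi] with t ht
      rw [norm_mul, Real.norm_of_nonneg (Real.exp_pos _).le]
      have h1 := mul_le_mul_of_nonneg_left (hav t (le_of_lt ht)) (Real.exp_pos (-(P.C * t))).le
      refine h1.trans_eq ?_
      ring
    rw [integral_const_mul] at hbd
    rw [dist_zero_right, hsub, hlap, norm_mul, Real.norm_of_nonneg hC.le]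
    calc _ ≤ P.C * (η / (A + 1) * ∫ t in Ioi (0 : ℝ),
          (t * Real.exp (-(P.C * t)) + Real.exp (-(P.C * t)))) := by
          gcongr
          exact hbd
      _ = η / (A + 1) * A := by rw [hA]; ring
      _ < η := by rw [div_mul_eq_mul_div, div_lt_iff₀ (by positivity)]; nlinarith
  have := hdiff.add hmain
  simpa using this

end Averaging

end SPProblem

/-! ### Discounted occupational measures and their weak limits. -/

theorem ContDiff.exists_lipschitzOnWith_of_isBounded {E : Type*} [NormedAddCommGroup E]
    [NormedSpace ℝ E] [FiniteDimensional ℝ E] {χ : E → ℝ} (hχ : ContDiff ℝ 1 χ) {s : Set E}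
    (hs : Bornology.IsBounded s) : ∃ K : ℝ≥0, LipschitzOnWith K χ s := by
  have := FiniteDimensional.proper_real E
  obtain ⟨R, hR⟩ := hs.subset_closedBall (0 : E)
  obtain ⟨K, hK⟩ := (isCompact_closedBall (0 : E) R).exists_bound_of_continuousOn
    (hχ.continuous_fderiv one_ne_zero).continuousOn
  refine ⟨K.toNNReal, ((convex_closedBall (0 : E) R).lipschitzOnWith_of_nnnorm_fderiv_le
    (fun x _ => (hχ.differentiable one_ne_zero).differentiableAt) fun x hx => ?_).mono hR⟩
  rw [← NNReal.coe_le_coe, coe_nnnorm]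
  exact (hK x hx).trans (Real.le_coe_toNNReal K)

/-- The probability measure with density `C * exp (-C t)` on the half line. -/
noncomputable def discountMeasure (C : ℝ) : Measure ℝ :=
  (volume.restrict (Ioi 0)).withDensity fun t => ENNReal.ofReal (C * Real.exp (-(C * t)))

theorem isProbabilityMeasure_discountMeasure {C : ℝ} (hC : 0 < C) :
    IsProbabilityMeasure (discountMeasure C) := by
  refine ⟨?_⟩
  rw [discountMeasure, withDensity_apply _ MeasurableSet.univ, Measure.restrict_univ,
    ← ofReal_integral_eq_lintegral_ofReal ((integrableOn_exp_neg_mul hC).const_mul C)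
      (Eventually.of_forall fun t => by positivity), integral_const_mul, integral_exp_neg_mul hC,
    mul_inv_cancel₀ hC.ne', ENNReal.ofReal_one]

theorem integral_discountMeasure {C : ℝ} (hC : 0 < C) (h : ℝ → ℝ) :
    ∫ t, h t ∂(discountMeasure C) = C * ∫ t in Ioi (0 : ℝ), Real.exp (-(C * t)) * h t := by
  rw [discountMeasure, integral_withDensity_eq_integral_toReal_smul (by fun_prop)
    (Eventually.of_forall fun t => ENNReal.ofReal_lt_top), ← integral_const_mul]
  refine integral_congr_ae (Eventually.of_forall fun t => ?_)
  simp only [smul_eq_mul]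
  rw [ENNReal.toReal_ofReal (by positivity)]
  ring

theorem ae_discountMeasure_pos (C : ℝ) : ∀ᵐ t ∂(discountMeasure C), 0 < t :=
  (withDensity_absolutelyContinuous _ _).ae_le (ae_restrict_mem measurableSet_Ioi)

namespace SPProblem

variable {U : Type*} {m n : ℕ} [MetricSpace U] [MeasurableSpace U] [CompactSpace U] [BorelSpace U]
  {P : SPProblem U m n}

theorem Standing.integrable_triple (hP : P.Standing) {V : Type*} [NormedAddCommGroup V]
    {p : U × Euc m × Euc n → V} (hp : Continuous p) (γ : Measure (U × P.Y × P.Z))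
    [IsFiniteMeasure γ] :
    Integrable (fun x : U × P.Y × P.Z => p (x.1, (x.2.1 : Euc m), (x.2.2 : Euc n))) γ := by
  have := hP.compactSpace_Y
  have := hP.compactSpace_Z
  exact (by fun_prop : Continuous fun x : U × P.Y × P.Z =>
    p (x.1, (x.2.1 : Euc m), (x.2.2 : Euc n))).integrable_of_hasCompactSupport
    (HasCompactSupport.of_compactSpace _)

/-- Integral of a function of `(u, y, z)` against a measure on `U × Y × Z`. -/
noncomputable def mean (P : SPProblem U m n) (p : U × Euc m × Euc n → ℝ)
    (γ : ProbabilityMeasure (U × P.Y × P.Z)) : ℝ :=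
  ∫ x, p (x.1, (x.2.1 : Euc m), (x.2.2 : Euc n)) ∂(γ : Measure (U × P.Y × P.Z))

omit [CompactSpace U] in
/-- The discounted occupational measure of a trajectory. -/
theorem IsSPTriple.exists_occupational (hP : P.Standing) {ε : ℝ} {u : ℝ → U} {y : ℝ → Euc m}
    {z : ℝ → Euc n} (h : P.IsSPTriple ε u y z)
    (hin : ∀ t : ℝ, 0 ≤ t → y t ∈ P.Y ∧ z t ∈ P.Z) :
    ∃ γ : ProbabilityMeasure (U × P.Y × P.Z), ∀ p : U × Euc m × Euc n → ℝ, Continuous p →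
      P.mean p γ = P.C * ∫ t in Ioi (0 : ℝ), Real.exp (-(P.C * t)) * p (u t, y t, z t) := by
  obtain ⟨hum, -, -, hyv, hzv⟩ := h
  have hmax : MapsTo (fun t : ℝ => max t 0) univ (Ici 0) := fun t _ => le_max_right t 0
  have hmc : Continuous fun t : ℝ => max t 0 := by fun_prop
  have hyc : Continuous fun t => y (max t 0) :=
    continuousOn_univ.1 (hyv.continuousOn.comp hmc.continuousOn hmax)
  have hzc : Continuous fun t => z (max t 0) :=
    continuousOn_univ.1 (hzv.continuousOn.comp hmc.continuousOn hmax)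
  -- Clamping time at `0` gives values in `Y × Z` for every real `t`; the discount measure does not
  -- charge negative times.
  let w : ℝ → U × P.Y × P.Z := fun t => (u t, ⟨y (max t 0), (hin _ (le_max_right t 0)).1⟩,
    ⟨z (max t 0), (hin _ (le_max_right t 0)).2⟩)
  have hw : Measurable w := hum.prodMk
    ((hyc.measurable.subtype_mk).prodMk (hzc.measurable.subtype_mk))
  have := isProbabilityMeasure_discountMeasure hP.C_pos
  refine ⟨⟨(discountMeasure P.C).map w, Measure.isProbabilityMeasure_map hw.aemeasurable⟩,
    fun p hp => ?_⟩
  rw [← integral_discountMeasure hP.C_pos]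
  change ∫ x, p (x.1, (x.2.1 : Euc m), (x.2.2 : Euc n)) ∂((discountMeasure P.C).map w) = _
  rw [integral_map hw.aemeasurable (by fun_prop : Continuous fun x : U × P.Y × P.Z =>
    p (x.1, (x.2.1 : Euc m), (x.2.2 : Euc n))).aestronglyMeasurable]
  refine integral_congr_ae ?_
  filter_upwards [ae_discountMeasure_pos P.C] with t ht
  simp only [w, max_eq_left ht.le]

/-- The equations satisfied by discounted occupational measures of trajectories. -/
theorem IsSPTriple.mean_eq (hP : P.Standing) {ε : ℝ} (hε : 0 < ε) {u : ℝ → U} {y : ℝ → Euc m}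
    {z : ℝ → Euc n} (h : P.IsSPTriple ε u y z)
    (hin : ∀ t : ℝ, 0 ≤ t → y t ∈ P.Y ∧ z t ∈ P.Z) {γ : ProbabilityMeasure (U × P.Y × P.Z)}
    (hγ : ∀ p : U × Euc m × Euc n → ℝ, Continuous p →
      P.mean p γ = P.C * ∫ t in Ioi (0 : ℝ), Real.exp (-(P.C * t)) * p (u t, y t, z t))
    {φ : Euc m → ℝ} (hφ : ContDiff ℝ 1 φ) {ψ : Euc n → ℝ} (hψ : ContDiff ℝ 1 ψ) :
    P.mean (fun x => ψ x.2.2 * fderiv ℝ φ x.2.1 (P.f x)) γ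
      = ε * (P.C * (P.mean (fun x => φ x.2.1 * ψ x.2.2) γ - φ P.y0 * ψ P.z0)
        - P.mean (fun x => φ x.2.1 * fderiv ℝ ψ x.2.2 (P.g x)) γ) := by
  have hfc := hP.f_cont
  have hgc := hP.g_cont
  have hφc := hφ.continuous
  have hψc := hψ.continuous
  have hφ' := hφ.continuous_fderiv one_ne_zero
  have hψ' := hψ.continuous_fderiv one_ne_zero
  have c1 : Continuous fun x : U × Euc m × Euc n => ψ x.2.2 * fderiv ℝ φ x.2.1 (P.f x) :=
    (hψc.comp (by fun_prop)).mul ((hφ'.comp (by fun_prop)).clm_apply hfc)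
  have c2 : Continuous fun x : U × Euc m × Euc n => φ x.2.1 * fderiv ℝ ψ x.2.2 (P.g x) :=
    (hφc.comp (by fun_prop)).mul ((hψ'.comp (by fun_prop)).clm_apply hgc)
  have c3 : Continuous fun x : U × Euc m × Euc n => φ x.2.1 * ψ x.2.2 := by fun_prop
  set p1 : U × Euc m × Euc n → ℝ := fun x => ψ x.2.2 * fderiv ℝ φ x.2.1 (P.f x) with hp1
  set p2 : U × Euc m × Euc n → ℝ := fun x => φ x.2.1 * fderiv ℝ ψ x.2.2 (P.g x) with hp2
  set p3 : U × Euc m × Euc n → ℝ := fun x => φ x.2.1 * ψ x.2.2 with hp3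
  obtain ⟨hum, hy0, hz0, hyv, hzv⟩ := h
  obtain ⟨Bf, hBf⟩ := hP.exists_norm_le hP.f_cont
  obtain ⟨Bg, hBg⟩ := hP.exists_norm_le hP.g_cont
  have c12 : Continuous fun x => ε⁻¹ * p1 x + p2 x := (c1.const_mul _).add c2
  obtain ⟨B, hB⟩ := hP.exists_norm_le c12
  obtain ⟨K, hK⟩ := ContDiff.exists_lipschitzOnWith_of_isBounded
    (χ := fun x : Euc m × Euc n => φ x.1 * ψ x.2)
    ((hφ.comp contDiff_fst).mul (hψ.comp contDiff_snd))
    (hP.Y_compact.isBounded.prod hP.Z_compact.isBounded)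
  have hylip := hyv.lipschitzOnWith (M := ‖ε⁻¹‖₊ * Bf) (fun t ht => by
    rw [norm_smul]
    push_cast
    gcongr
    exact hBf _ _ (hin t ht).1 _ (hin t ht).2)
  have hzlip := hzv.lipschitzOnWith (M := Bg) fun t ht => hBg _ _ (hin t ht).1 _ (hin t ht).2
  have hFlip := hK.comp (hylip.prodMk hzlip) fun t ht => ⟨(hin t ht).1, (hin t ht).2⟩
  -- The chain rule for `φ(y) ψ(z)`. Its Laplace transform, multiplied by `ε`, is the asserted
  -- identity.
  have hd : ∀ᵐ t, 0 < t → HasDerivAt ((fun x : Euc m × Euc n => φ x.1 * ψ x.2) ∘ fun t => (y t, z t))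
      (ε⁻¹ * p1 (u t, y t, z t) + p2 (u t, y t, z t)) t := by
    filter_upwards [hyv.ae_hasDerivAt, hzv.ae_hasDerivAt] with t h1 h2 ht
    have e1 := ((hφ.differentiable one_ne_zero).differentiableAt (x := y t)).hasFDerivAt
      |>.comp_hasDerivAt t (h1 ht)
    have e2 := ((hψ.differentiable one_ne_zero).differentiableAt (x := z t)).hasFDerivAt
      |>.comp_hasDerivAt t (h2 ht)
    refine (e1.mul e2).congr_deriv ?_
    simp only [hp1, hp2, map_smul, smul_eq_mul, Function.comp]
    ring
  have hm := (aestronglyMeasurable_comp_triple hum hyv.continuousOn hzv.continuousOn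
    c12).mono_measure (Measure.restrict_mono (Ioi_subset_Ici_self (a := (0 : ℝ))) le_rfl)
  have hlap := integral_exp_neg_mul_deriv hP.C_pos hFlip hd
    (integrableOn_exp_neg_mul_of_bounded hP.C_pos hm fun t ht =>
      hB _ _ (hin t ht.le).1 _ (hin t ht.le).2)
  have g12 := hγ _ c12
  have g3 := hγ _ c3
  have hadd : P.mean (fun x => ε⁻¹ * p1 x + p2 x) γ = ε⁻¹ * P.mean p1 γ + P.mean p2 γ := by
    rw [mean, integral_add ((hP.integrable_triple c1 (γ : Measure _)).const_mul _)
      (hP.integrable_triple c2 (γ : Measure _)), integral_const_mul]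
    rfl
  rw [hlap] at g12
  simp only [Function.comp, hy0, hz0] at g12
  have g12' : ε⁻¹ * P.mean p1 γ + P.mean p2 γ
      = P.C * (-(φ P.y0 * ψ P.z0) + P.mean p3 γ) := by rw [← hadd, g12, g3]
  have : P.mean p1 γ = ε * (ε⁻¹ * P.mean p1 γ) := by
    rw [← mul_assoc, mul_inv_cancel₀ hε.ne', one_mul]
  rw [this]
  congr 1
  linarith

/-- If trajectories with small parameters have discounted cost at most `c`, then some measure on
`U × Y × Z` satisfying the limit equations has cost at most `c`. -/
theorem Standing.exists_limit_occupational (hP : P.Standing) {c : ℝ}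
    (hc : ∃ᶠ ε in 𝓝[>] (0 : ℝ), ∃ u y z, P.IsSPTriple ε u y z ∧ P.C * P.cost u y z ≤ c) :
    ∃ γ : ProbabilityMeasure (U × P.Y × P.Z),
      (∀ (φ : Euc m → ℝ) (ψ : Euc n → ℝ), ContDiff ℝ 1 φ → ContDiff ℝ 1 ψ →
        P.mean (fun x => ψ x.2.2 * fderiv ℝ φ x.2.1 (P.f x)) γ = 0) ∧
      (∀ ψ : Euc n → ℝ, ContDiff ℝ 1 ψ →
        P.mean (fun x => fderiv ℝ ψ x.2.2 (P.g x)) γ = P.C * (P.mean (fun x => ψ x.2.2) γ - ψ P.z0))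
      ∧ P.mean P.G γ ≤ c := by
  have := hP.compactSpace_Y
  have := hP.compactSpace_Z
  set S : Set ℝ := {ε | 0 < ε ∧ ∃ γ : ProbabilityMeasure (U × P.Y × P.Z),
    (∀ (φ : Euc m → ℝ) (ψ : Euc n → ℝ), ContDiff ℝ 1 φ → ContDiff ℝ 1 ψ →
      P.mean (fun x => ψ x.2.2 * fderiv ℝ φ x.2.1 (P.f x)) γ
      = ε * (P.C * (P.mean (fun x => φ x.2.1 * ψ x.2.2) γ - φ P.y0 * ψ P.z0)
        - P.mean (fun x => φ x.2.1 * fderiv ℝ ψ x.2.2 (P.g x)) γ)) ∧ P.mean P.G γ ≤ c} with hS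
  have hfreq : ∃ᶠ ε in 𝓝[>] (0 : ℝ), ε ∈ S := by
    refine (hc.and_eventually (hP.invariant.and self_mem_nhdsWithin)).mono ?_
    rintro ε ⟨⟨u, y, z, h, hle⟩, hin, hε⟩
    replace hε : 0 < ε := hε
    obtain ⟨γ, hγ⟩ := h.exists_occupational hP (hin u y z h)
    refine ⟨hε, γ, fun φ ψ hφ hψ => h.mean_eq hP hε (hin u y z h) hγ hφ hψ, ?_⟩
    rw [hγ _ hP.G_cont]
    exact hle
  have hne : (𝓝[>] (0 : ℝ) ⊓ 𝓟 S).NeBot := frequently_mem_iff_neBot.1 hfreq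
  -- An ultrafilter along the parameters in `S` serves as a subsequence; compactness of the space of
  -- probability measures provides the limit.
  set 𝓤 := Ultrafilter.of (𝓝[>] (0 : ℝ) ⊓ 𝓟 S) with h𝓤
  have hle := Ultrafilter.of_le (𝓝[>] (0 : ℝ) ⊓ 𝓟 S)
  have h𝓤S : S ∈ 𝓤 := hle (mem_inf_of_right (mem_principal_self S))
  have h𝓤0 : Tendsto (fun ε : ℝ => ε) 𝓤 (𝓝 0) :=
    (hle.trans inf_le_left).trans nhdsWithin_le_nhds
  obtain ⟨ε0, hε0⟩ := hfreq.exists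
  have : Nonempty (ProbabilityMeasure (U × P.Y × P.Z)) := ⟨hε0.2.choose⟩
  classical
  set Γ : ℝ → ProbabilityMeasure (U × P.Y × P.Z) := fun ε =>
    if h : ε ∈ S then h.2.choose else hε0.2.choose with hΓ
  have hΓS : ∀ ε (h : ε ∈ S), Γ ε = h.2.choose := fun ε h => dif_pos h
  obtain ⟨γ, -, hγ⟩ := isCompact_univ.ultrafilter_le_nhds (𝓤.map Γ) (by simp)
  have hlim : ∀ p : U × Euc m × Euc n → ℝ, Continuous p →
      Tendsto (fun ε => P.mean p (Γ ε)) 𝓤 (𝓝 (P.mean p γ)) := fun p hp =>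
    ProbabilityMeasure.tendsto_iff_forall_integral_tendsto.1 (show Tendsto Γ 𝓤 (𝓝 γ) from hγ)
      (BoundedContinuousFunction.mkOfCompact ⟨fun x : U × P.Y × P.Z =>
        p (x.1, (x.2.1 : Euc m), (x.2.2 : Euc n)), by fun_prop⟩)
  have hfc := hP.f_cont
  have hgc := hP.g_cont
  refine ⟨γ, fun φ ψ hφ hψ => ?_, fun ψ hψ => ?_, ?_⟩
  · have hφ' := hφ.continuous_fderiv one_ne_zero
    have hψ' := hψ.continuous_fderiv one_ne_zero
    have l1 := hlim (fun x => ψ x.2.2 * fderiv ℝ φ x.2.1 (P.f x))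
      ((hψ.continuous.comp (by fun_prop)).mul ((hφ'.comp (by fun_prop)).clm_apply hfc))
    have l2 := hlim (fun x => φ x.2.1 * fderiv ℝ ψ x.2.2 (P.g x))
      ((hφ.continuous.comp (by fun_prop)).mul ((hψ'.comp (by fun_prop)).clm_apply hgc))
    have l3 := hlim (fun x => φ x.2.1 * ψ x.2.2)
      ((hφ.continuous.comp (by fun_prop)).mul (hψ.continuous.comp (by fun_prop)))
    have l4 := h𝓤0.mul (((l3.sub_const (φ P.y0 * ψ P.z0)).const_mul P.C).sub l2)
    rw [zero_mul] at l4
    refine tendsto_nhds_unique (l1.congr' ?_) l4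
    filter_upwards [h𝓤S] with ε hε
    rw [hΓS ε hε]
    exact hε.2.choose_spec.1 φ ψ hφ hψ
  · have hψ' := hψ.continuous_fderiv one_ne_zero
    have l2 := hlim (fun x => fderiv ℝ ψ x.2.2 (P.g x)) ((hψ'.comp (by fun_prop)).clm_apply hgc)
    have l3 := hlim (fun x => ψ x.2.2) (hψ.continuous.comp (by fun_prop))
    refine tendsto_nhds_unique (l2.congr' ?_) ((l3.sub_const (ψ P.z0)).const_mul P.C)
    filter_upwards [h𝓤S] with ε hε
    -- For `φ = 1` the left side vanishes and the factor `ε` cancels, so the slow equation holds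
    -- exactly for every `ε` in `S`.
    have h1 := hε.2.choose_spec.1 (fun _ => 1) ψ contDiff_const hψ
    rw [← hΓS ε hε] at h1
    have h0 : P.mean (fun x => ψ x.2.2 * fderiv ℝ (fun _ : Euc m => (1 : ℝ)) x.2.1 (P.f x)) (Γ ε)
        = 0 := by simp [mean]
    rw [h0] at h1
    simp only [one_mul] at h1
    have := (mul_eq_zero.1 h1.symm).resolve_left hε.1.ne'
    linarith
  · refine le_of_tendsto (hlim P.G hP.G_cont) ?_
    filter_upwards [h𝓤S] with ε hε
    rw [hΓS ε hε]
    exact hε.2.choose_spec.2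

end SPProblem

/-! ### Disintegration and the lower bound by the averaged linear program. -/

namespace SPProblem

variable {U : Type*} {m n : ℕ} [MetricSpace U] [MeasurableSpace U] [CompactSpace U] [BorelSpace U]
  {P : SPProblem U m n}

/-- It suffices to test membership in the limit sets with countably many functions. -/
theorem Standing.exists_countable_test (hP : P.Standing) :
    ∃ φ : ℕ → Euc m → ℝ, (∀ k, ContDiff ℝ 1 (φ k)) ∧
      ∀ (ζ : P.Z) (ν : ProbabilityMeasure (U × P.Y)),
        (∀ k, P.avg (fun x => fderiv ℝ (φ k) x.2.1 (P.f x)) ν ζ = 0) → ν ∈ P.limitSet ζ := by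
  have := hP.compactSpace_Y
  obtain ⟨B, hB⟩ := hP.exists_norm_le hP.f_cont
  -- Only the derivative on `Y` matters. The derivatives form a subset of a separable metric space,
  -- hence have a countable dense subset of their own; boundedness of `f` passes the equation to the
  -- closure.
  let D : {φ : Euc m → ℝ // ContDiff ℝ 1 φ} → C(P.Y, Euc m →L[ℝ] ℝ) := fun φ =>
    ⟨fun y => fderiv ℝ φ.1 y, (φ.2.continuous_fderiv one_ne_zero).comp continuous_subtype_val⟩
  have : Nonempty {φ : Euc m → ℝ // ContDiff ℝ 1 φ} := ⟨⟨fun _ => 0, contDiff_const⟩⟩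
  have hne : Nonempty (range D) := (range_nonempty D).to_subtype
  let d : ℕ → range D := TopologicalSpace.denseSeq (range D)
  choose φ hφ using fun k => (d k).2
  have hcont : ∀ {χ : Euc m → ℝ}, ContDiff ℝ 1 χ →
      Continuous fun x : U × Euc m × Euc n => fderiv ℝ χ x.2.1 (P.f x) := fun hχ =>
    ((hχ.continuous_fderiv one_ne_zero).comp (by fun_prop)).clm_apply hP.f_cont
  refine ⟨fun k => (φ k).1, fun k => (φ k).2, fun ζ ν h χ hχ => ?_⟩
  change P.avg (fun x => fderiv ℝ χ x.2.1 (P.f x)) ν ζ = 0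
  refine abs_nonpos_iff.1 (le_of_forall_pos_le_add fun η hη => ?_)
  obtain ⟨k, hk⟩ := (TopologicalSpace.denseRange_denseSeq (range D)).exists_dist_lt
    (⟨D ⟨χ, hχ⟩, mem_range_self _⟩ : range D) (show 0 < η / (B + 1) by positivity)
  have hk' : dist (D ⟨χ, hχ⟩) (D (φ k)) < η / (B + 1) := by
    rw [hφ k]; exact hk
  have hsub : P.avg (fun x => fderiv ℝ χ x.2.1 (P.f x)) ν ζ
      = ∫ x, (fderiv ℝ χ (x.2 : Euc m) (P.f (x.1, (x.2 : Euc m), (ζ : Euc n)))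
        - fderiv ℝ (φ k).1 (x.2 : Euc m) (P.f (x.1, (x.2 : Euc m), (ζ : Euc n))))
        ∂(ν : Measure (U × P.Y)) := by
    have h1 := integral_sub (hP.integrable_avg (hcont hχ) (ν : Measure (U × P.Y)) ζ)
      (hP.integrable_avg (hcont (φ k).2) (ν : Measure (U × P.Y)) ζ)
    have h2 := h k
    simp only [avg] at h2 ⊢
    rw [h1, h2, sub_zero]
  rw [hsub]
  have := norm_integral_le_of_norm_le_const (μ := (ν : Measure (U × P.Y))) (C := η)
    (f := fun x => fderiv ℝ χ (x.2 : Euc m) (P.f (x.1, (x.2 : Euc m), (ζ : Euc n)))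
        - fderiv ℝ (φ k).1 (x.2 : Euc m) (P.f (x.1, (x.2 : Euc m), (ζ : Euc n))))
    (Eventually.of_forall fun x => by
      rw [← sub_apply]
      refine (ContinuousLinearMap.le_opNorm _ _).trans ?_
      have h3 : ‖fderiv ℝ χ (x.2 : Euc m) - fderiv ℝ (φ k).1 (x.2 : Euc m)‖ ≤ η / (B + 1) := by
        rw [← dist_eq_norm]
        exact (ContinuousMap.dist_apply_le_dist (f := D ⟨χ, hχ⟩) (g := D (φ k)) x.2).trans hk'.le
      calc _ ≤ η / (B + 1) * B := by
            gcongr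
            exact hB _ _ x.2.2 _ ζ.2
        _ ≤ η := by
            rw [div_mul_eq_mul_div, div_le_iff₀ (by positivity)]
            nlinarith [B.coe_nonneg])
  simpa using this

-- The measure component of a point of the graph is a Markov kernel, and integration against a
-- kernel preserves measurability.
omit [CompactSpace U] in
theorem stronglyMeasurable_avg {p : U × Euc m × Euc n → ℝ} (hp : Continuous p) :
    StronglyMeasurable fun x : P.graphW => P.avg p x.1.1 x.1.2 := by
  let K : ProbabilityTheory.Kernel P.graphW (U × P.Y) :=
    ⟨fun x => (x.1.1 : Measure (U × P.Y)),
      measurable_subtype_coe.comp (measurable_fst.comp measurable_subtype_coe)⟩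
  have : ProbabilityTheory.IsMarkovKernel K := ⟨fun x => inferInstanceAs
    (IsProbabilityMeasure (x.1.1 : Measure (U × P.Y)))⟩
  have hm : Measurable fun x : P.graphW × (U × P.Y) =>
      p (x.2.1, (x.2.2 : Euc m), (x.1.1.2 : Euc n)) := by
    refine hp.measurable.comp ?_
    fun_prop
  exact hm.stronglyMeasurable.integral_kernel_prod_right' (κ := K)

/-- Disintegration of a solution of the limit equations into a measure on the graph of `W`. -/
theorem Standing.exists_graph_measure (hP : P.Standing) {γ : ProbabilityMeasure (U × P.Y × P.Z)}
    (hγ : ∀ (φ : Euc m → ℝ) (ψ : Euc n → ℝ), ContDiff ℝ 1 φ → ContDiff ℝ 1 ψ →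
        P.mean (fun x => ψ x.2.2 * fderiv ℝ φ x.2.1 (P.f x)) γ = 0) :
    ∃ ρ : ProbabilityMeasure P.graphW, ∀ p : U × Euc m × Euc n → ℝ, Continuous p →
      ∫ x : P.graphW, P.avg p x.1.1 x.1.2 ∂(ρ : Measure P.graphW) = P.mean p γ := by
  have := hP.compactSpace_Y
  have := hP.compactSpace_Z
  have hne : Nonempty (U × P.Y × P.Z) := nonempty_of_isProbabilityMeasure (γ : Measure _)
  have hne' : Nonempty (U × P.Y) := hne.map fun x => (x.1, x.2.1)
  -- The slow variable goes first and is viewed in the whole of `Euc n`, so that one can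
  -- disintegrate over it and test with smooth functions there.
  let e : U × P.Y × P.Z → Euc n × (U × P.Y) := fun x => ((x.2.2 : Euc n), (x.1, x.2.1))
  have he : Measurable e := by fun_prop
  let M : Measure (Euc n × (U × P.Y)) := (γ : Measure (U × P.Y × P.Z)).map e
  have hM : IsProbabilityMeasure M := Measure.isProbabilityMeasure_map he.aemeasurable
  have hmeas : ∀ {p : U × Euc m × Euc n → ℝ}, Continuous p → Continuous
      fun x : Euc n × (U × P.Y) => p (x.2.1, (x.2.2 : Euc m), x.1) := fun hp => by fun_prop
  have hint : ∀ {p : U × Euc m × Euc n → ℝ}, Continuous p →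
      Integrable (fun x : Euc n × (U × P.Y) => p (x.2.1, (x.2.2 : Euc m), x.1)) M := by
    intro p hp
    rw [integrable_map_measure (hmeas hp).aestronglyMeasurable he.aemeasurable]
    exact hP.integrable_triple hp (γ : Measure _)
  have hmean : ∀ {p : U × Euc m × Euc n → ℝ}, Continuous p →
      ∫ ζ, ∫ w, p (w.1, (w.2 : Euc m), ζ) ∂(M.condKernel ζ) ∂M.fst = P.mean p γ := by
    intro p hp
    rw [Measure.integral_condKernel (hint hp), integral_map he.aemeasurable
      (hmeas hp).aestronglyMeasurable]
    rfl
  have hfib : ∀ {p : U × Euc m × Euc n → ℝ}, Continuous p →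
      Integrable (fun ζ => ∫ w, p (w.1, (w.2 : Euc m), ζ) ∂(M.condKernel ζ)) M.fst := fun hp =>
    (hint hp).integral_condKernel
  obtain ⟨φ, hφ, hφW⟩ := hP.exists_countable_test
  have hcont : ∀ {χ : Euc m → ℝ}, ContDiff ℝ 1 χ →
      Continuous fun x : U × Euc m × Euc n => fderiv ℝ χ x.2.1 (P.f x) := fun hχ =>
    ((hχ.continuous_fderiv one_ne_zero).comp (by fun_prop)).clm_apply hP.f_cont
  -- The factor `ψ(z)` in the limit equations is arbitrary, which forces the fibre integrals to
  -- vanish almost everywhere. Countably many `φ k` leave a single null set.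
  have hzero : ∀ k, ∀ᵐ ζ ∂M.fst, ∫ w, fderiv ℝ (φ k) (w.2 : Euc m) (P.f (w.1, (w.2 : Euc m), ζ))
      ∂(M.condKernel ζ) = 0 := by
    intro k
    refine ae_eq_zero_of_integral_contDiff_smul_eq_zero (hfib (hcont (hφ k))).locallyIntegrable
      fun ψ hψ _ => ?_
    have hψ1 : ContDiff ℝ 1 ψ := hψ.of_le (by exact_mod_cast le_top)
    have hc : Continuous fun x : U × Euc m × Euc n => ψ x.2.2 * fderiv ℝ (φ k) x.2.1 (P.f x) :=
      (hψ1.continuous.comp (by fun_prop)).mul (hcont (hφ k))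
    rw [← hγ (φ k) ψ (hφ k) hψ1, ← hmean hc]
    refine integral_congr_ae (Eventually.of_forall fun ζ => ?_)
    simp only [smul_eq_mul]
    rw [← integral_const_mul]
  have hZ : ∀ᵐ ζ ∂M.fst, ζ ∈ P.Z := by
    have h1 : M.fst = (γ : Measure (U × P.Y × P.Z)).map fun x => (x.2.2 : Euc n) := by
      rw [Measure.fst, Measure.map_map measurable_fst he]
      rfl
    rw [h1]
    refine (ae_map_iff (p := (· ∈ P.Z)) (by fun_prop) hP.Z_compact.measurableSet).2 ?_
    exact Eventually.of_forall fun x => x.2.2.2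
  obtain ⟨E, hE, hEm, hEp⟩ := ((ae_all_iff.2 hzero).and hZ).exists_measurable_mem
  have hMf : IsProbabilityMeasure M.fst := inferInstance
  obtain ⟨ζ1, hζ1⟩ := (show ∃ᶠ ζ in ae M.fst, ζ ∈ E from Eventually.frequently hE).exists
  classical
  -- Outside the good set `E` the fibre over one fixed good point is used, so that `T` takes values
  -- in the graph everywhere.
  let r : Euc n → Euc n := fun ζ => if ζ ∈ E then ζ else ζ1
  have hr : Measurable r := Measurable.ite hEm measurable_id measurable_const
  have hrE : ∀ ζ, r ζ ∈ E := fun ζ => by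
    simp only [r]; split_ifs with h
    · exact h
    · exact hζ1
  let T : Euc n → P.graphW := fun ζ =>
    ⟨(⟨M.condKernel (r ζ), inferInstance⟩, ⟨r ζ, (hEp _ (hrE ζ)).2⟩),
      hφW ⟨r ζ, (hEp _ (hrE ζ)).2⟩ ⟨M.condKernel (r ζ), inferInstance⟩
        fun k => (hEp _ (hrE ζ)).1 k⟩
  have hT : Measurable T := by
    refine Measurable.subtype_mk (Measurable.prodMk (Measurable.subtype_mk ?_) hr.subtype_mk)
    exact M.condKernel.measurable.comp hr
  refine ⟨⟨M.fst.map T, Measure.isProbabilityMeasure_map hT.aemeasurable⟩, fun p hp => ?_⟩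
  change ∫ x : P.graphW, P.avg p x.1.1 x.1.2 ∂(M.fst.map T) = _
  rw [integral_map hT.aemeasurable (stronglyMeasurable_avg hp).aestronglyMeasurable, ← hmean hp]
  refine integral_congr_ae ?_
  filter_upwards [hE] with ζ hζ
  have : r ζ = ζ := if_pos hζ
  simp only [avg, T, this]
  rfl

/-- The value of the averaged linear program bounds the scaled costs from below in the limit. -/
theorem Standing.eventually_lt_cost (hP : P.Standing) {c : ℝ} (hc : c < P.lpValue) :
    ∀ᶠ ε in 𝓝[>] (0 : ℝ), ∀ u y z, P.IsSPTriple ε u y z → c < P.C * P.cost u y z := by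
  by_contra hcon
  have hfreq : ∃ᶠ ε in 𝓝[>] (0 : ℝ), ∃ u y z, P.IsSPTriple ε u y z ∧ P.C * P.cost u y z ≤ c := by
    refine (not_eventually.1 hcon).mono fun ε h => ?_
    push Not at h
    exact h
  obtain ⟨γ, h1, h2, h3⟩ := hP.exists_limit_occupational hfreq
  obtain ⟨ρ, hρ⟩ := hP.exists_graph_measure h1
  obtain ⟨B, hB⟩ := hP.exists_norm_le hP.G_cont
  have hbdd : BddBelow {c : ℝ | ∃ p ∈ P.lpFeasible,
      c = ∫ x : P.graphW, P.avg P.G x.1.1 x.1.2 ∂(p : Measure P.graphW)} := by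
    refine ⟨-(B : ℝ), ?_⟩
    rintro _ ⟨ρ', -, rfl⟩
    have := norm_integral_le_of_norm_le_const (μ := (ρ' : Measure P.graphW))
      (f := fun x => P.avg P.G x.1.1 x.1.2) (C := B)
      (Eventually.of_forall fun x => norm_avg_le hB _ _)
    simp only [probReal_univ, mul_one] at this
    exact (abs_le.1 this).1
  have hmem : ρ ∈ P.lpFeasible := by
    intro ψ hψ
    have hg : Continuous fun x : U × Euc m × Euc n => fderiv ℝ ψ x.2.2 (P.g x) :=
      ((hψ.continuous_fderiv one_ne_zero).comp (by fun_prop)).clm_apply hP.g_cont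
    have hψc : Continuous fun x : U × Euc m × Euc n => ψ x.2.2 := hψ.continuous.comp (by fun_prop)
    have hpc : Continuous fun x : U × Euc m × Euc n =>
        fderiv ℝ ψ x.2.2 (P.g x) + P.C * (ψ P.z0 - ψ x.2.2) := by fun_prop
    -- Linearity of the derivative and unit mass turn the constraint integrand into the average of
    -- one continuous function, to which `hρ` applies.
    have hcong : ∀ x : P.graphW, fderiv ℝ ψ (x.1.2 : Euc n) (P.avg P.g x.1.1 x.1.2)
        + P.C * (ψ P.z0 - ψ (x.1.2 : Euc n))
        = P.avg (fun x => fderiv ℝ ψ x.2.2 (P.g x) + P.C * (ψ P.z0 - ψ x.2.2)) x.1.1 x.1.2 := by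
      intro x
      have i1 : Integrable (fun w : U × P.Y => fderiv ℝ ψ (x.1.2 : Euc n)
          (P.g (w.1, (w.2 : Euc m), (x.1.2 : Euc n)))) (x.1.1 : Measure (U × P.Y)) :=
        hP.integrable_avg hg (x.1.1 : Measure (U × P.Y)) x.1.2
      change _ = ∫ w : U × P.Y, (fderiv ℝ ψ (x.1.2 : Euc n)
          (P.g (w.1, (w.2 : Euc m), (x.1.2 : Euc n))) + P.C * (ψ P.z0 - ψ (x.1.2 : Euc n)))
          ∂(x.1.1 : Measure (U × P.Y))
      rw [integral_add i1 (integrable_const _), ContinuousLinearMap.integral_comp_comm _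
        (hP.integrable_avg hP.g_cont (x.1.1 : Measure (U × P.Y)) x.1.2)]
      simp [avg]
    simp only [hcong]
    have i1 := hP.integrable_triple hg (γ : Measure (U × P.Y × P.Z))
    have i2 := hP.integrable_triple hψc (γ : Measure (U × P.Y × P.Z))
    have i3 : Integrable (fun x : U × P.Y × P.Z => P.C * (ψ P.z0 - ψ (x.2.2 : Euc n)))
        (γ : Measure (U × P.Y × P.Z)) := ((integrable_const _).sub i2).const_mul _
    have h4 := h2 ψ hψ
    simp only [mean] at h4
    rw [hρ _ hpc, mean, integral_add i1 i3, h4, integral_const_mul,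
      integral_sub (integrable_const _) i2]
    simp
    ring
  exact absurd hc (not_lt.2 ((csInf_le hbdd ⟨ρ, hmem, rfl⟩).trans
    ((hρ P.G hP.G_cont).le.trans h3)))

end SPProblem

/-! ### Comparison of optimal values and conclusion. -/

namespace SPProblem

variable {U : Type*} {m n : ℕ} [MetricSpace U] [MeasurableSpace U] [CompactSpace U] [BorelSpace U]
  {P : SPProblem U m n}

-- Invariance keeps every trajectory in `Y × Z`, so all costs are at least `-B / C`. This lower
-- bound makes the infimum a genuine one.
omit [BorelSpace U] in
theorem Standing.eventually_value_le (hP : P.Standing) :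
    ∀ᶠ ε in 𝓝[>] (0 : ℝ), ∀ u y z, P.IsSPTriple ε u y z → P.value ε ≤ P.cost u y z := by
  obtain ⟨B, hB⟩ := hP.exists_norm_le hP.G_cont
  filter_upwards [hP.invariant] with ε hin u y z h
  refine csInf_le ⟨-(P.C⁻¹ * B), ?_⟩ ⟨u, y, z, h, rfl⟩
  rintro _ ⟨u', y', z', h', rfl⟩
  have hb : ‖P.cost u' y' z'‖ ≤ ∫ t in Ioi (0 : ℝ), Real.exp (-(P.C * t)) * B := by
    refine norm_integral_le_of_norm_le ((integrableOn_exp_neg_mul hP.C_pos).mul_const _) ?_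
    filter_upwards [ae_restrict_mem measurableSet_Ioi] with t ht
    have ht0 : (0 : ℝ) ≤ t := le_of_lt ht
    rw [norm_mul, Real.norm_of_nonneg (Real.exp_pos _).le]
    gcongr
    exact hB _ _ (hin _ _ _ h' t ht0).1 _ (hin _ _ _ h' t ht0).2
  rw [integral_mul_const, integral_exp_neg_mul hP.C_pos] at hb
  exact (abs_le.1 hb).1

/-- The value of the averaged linear program bounds the scaled optimal values from below in the
limit. -/
theorem Standing.eventually_le_value (hP : P.Standing) {c : ℝ} (hc : P.C * c < P.lpValue)
    (hne : ∀ᶠ ε in 𝓝[>] (0 : ℝ), ∃ u y z, P.IsSPTriple ε u y z) :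
    ∀ᶠ ε in 𝓝[>] (0 : ℝ), c ≤ P.value ε := by
  -- Existence of a trajectory is essential: the infimum of the empty set has the default value `0`.
  filter_upwards [hP.eventually_lt_cost hc, hne] with ε h1 ⟨u, y, z, h2⟩
  refine le_csInf ⟨_, u, y, z, h2, rfl⟩ ?_
  rintro _ ⟨u', y', z', h', rfl⟩
  exact (lt_of_mul_lt_mul_left (h1 u' y' z' h') hP.C_pos.le).le

end SPProblem

theorem mainTheorem3 {U : Type*} [MetricSpace U] [CompactSpace U] [MeasurableSpace U]
    [BorelSpace U] {m n : ℕ} (P : SPProblem U m n) (hP : P.Standing)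
    (q : ℕ → U × P.Y → ℝ) (hq : IsTestSequence q)
    (uz : P.Z → ℝ → U) (yz : P.Z → ℝ → P.Y)
    (μ : P.Z → ProbabilityMeasure (U × P.Y)) (z : ℝ → P.Z)
    (hACG : P.IsACGFamily uz yz μ z)
    (us : P.Y → P.Z → ℝ → U) (ys : P.Y → P.Z → ℝ → P.Y)
    (hsteer : P.IsUniformSteering q μ us ys)
    (hlip : P.IsWeaklyPiecewiseLipschitz μ z)
    (L : ℝ) (hL : P.IsLipConstF L)
    (uε : ℝ → ℝ → U) (yε : ℝ → ℝ → P.Y) (zε : ℝ → ℝ → P.Z)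
    (hconstr : ∀ᶠ ε in 𝓝[>] (0 : ℝ), P.IsConstructed L us ε (uε ε) (yε ε) (zε ε))
    (htube : P.StaysInTube μ z zε)
    (hval : Tendsto P.value (𝓝[>] 0) (𝓝 P.avgValue) ∨ P.C * P.avgValue = P.lpValue) :
    (P.IsOptimalACG μ z → P.IsAsympOptimal uε yε zε) ∧
    ∀ α : ℝ, 0 < α → P.IsNearOptimalACG α μ z → P.IsAsympNearOptimal α uε yε zε := by
  have hcost := SPProblem.tendsto_cost_constructed hP hq hsteer hL hconstr hACG.flow htube hlip
  have hle : ∀ᶠ ε in 𝓝[>] (0 : ℝ), P.value ε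
      ≤ P.cost (uε ε) (fun t => (yε ε t : Euc m)) (fun t => (zε ε t : Euc n)) := by
    filter_upwards [hP.eventually_value_le, hconstr] with ε h1 h2 using h1 _ _ _ h2.1
  -- Either alternative of `hval` is used only through this lower estimate; the upper one comes from
  -- the constructed controls.
  have hlower : ∀ c < P.avgValue, ∀ᶠ ε in 𝓝[>] (0 : ℝ), c ≤ P.value ε := by
    intro c hc
    rcases hval with hval | hval
    · exact (hval.eventually_const_lt hc).mono fun ε h => h.le
    · refine hP.eventually_le_value (hval ▸ mul_lt_mul_of_pos_left hc hP.C_pos) ?_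
      exact hconstr.mono fun ε h => ⟨_, _, _, h.1⟩
  refine ⟨fun hopt => ⟨_, hcost, ?_⟩, fun α _ hnear => ⟨_, hcost, ?_⟩⟩
  · rw [SPProblem.IsOptimalACG] at hopt
    rw [hopt] at hcost ⊢
    refine tendsto_order.2 ⟨fun c hc => ?_, fun c hc => ?_⟩
    · obtain ⟨c', hc', hc''⟩ := exists_between hc
      exact (hlower c' hc'').mono fun ε h => hc'.trans_le h
    · filter_upwards [hle, hcost.eventually_lt_const hc] with ε h1 h2 using h1.trans_lt h2
  · refine hnear.trans (add_le_add_left ?_ α)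
    -- In `ℝ` the liminf is meaningful only if the values do not escape to `+∞`; the convergent
    -- costs bound them from above.
    have hcob : IsCoboundedUnder (· ≥ ·) (𝓝[>] (0 : ℝ)) P.value :=
      (hcost.isBoundedUnder_le.mono_le hle).isCoboundedUnder_ge
    exact le_of_forall_lt_imp_le_of_dense fun c hc => le_liminf_of_le hcob (hlower c hc)
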